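/- Let $\Bbbk$ be a field of characteristic $0$, let $g,s$ be natural numbers, and let $\Bbbk\langle x\rangle$ be the free (unital associative) $\Bbbk$-algebra on $x=(x_1,\dots,x_g)$. Let $Y=(Y_1,\dots,Y_g)$ be a semisimple $g$-tuple of $s\times s$ matrices over $\Bbbk$, i.e., every subspace of $\Bbbk^s$ invariant under all $Y_j$ has a complementary subspace invariant under all $Y_j$. For a $g$-tuple $Z$ and a matrix $S$ in $M_s(\Bbbk)$ write $SZ=(SZ_j)_j$, $ZS=(Z_jS)_j$ and $[S,Z]=SZ-ZS$. A *formal nc germ about $Y$* is a sequence $(f_\ell)_{\ell\ge0}$ of $\ell$-linear maps $f_\ell:(M_s(\Bbbk)^g)^\ell\to M_s(\Bbbk)$ such that $f_1([S,Y])=[S,f_0]$ and, for all $\ell\ge2$, $1\le j\le \ell-2$, $S\in M_s(\Bbbk)$ and $Z^i\in M_s(\Bbbk)^g$, $$f_\ell([S,Y],Z^1,\dots,Z^{\ell-1})=Sf_{\ell-1}(Z^1,\dots,Z^{\ell-1})-f_{\ell-1}(SZ^1,Z^2,\dots,Z^{\ell-1}),$$ $$f_\ell(\dots,Z^j,[S,Y],Z^{j+1},\dots)=f_{\ell-1}(\dots,Z^jS,Z^{j+1},\dots)-f_{\ell-1}(\dots,Z^j,SZ^{j+1},\dots),$$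 $$f_\ell(Z^1,\dots,Z^{\ell-1},[S,Y])=f_{\ell-1}(Z^1,\dots,Z^{\ell-2},Z^{\ell-1}S)-f_{\ell-1}(Z^1,\dots,Z^{\ell-1})S.$$ With termwise addition and the convolution product $(fh)_n(Z^1,\dots,Z^n)=\sum_{i=0}^n f_i(Z^1,\dots,Z^i)\,h_{n-i}(Z^{i+1},\dots,Z^n)$, the formal nc germs about $Y$ form a $\Bbbk$-algebra $\mathcal O_Y$. For $p\in\Bbbk\langle x\rangle$ and $Z^1,\dots,Z^\ell\in M_s(\Bbbk)^g$, let $B(Z^1,\dots,Z^\ell)$ be the $g$-tuple of $(\ell+1)\times(\ell+1)$ block matrices with diagonal blocks $Y$, blocks $Z^1,\dots,Z^\ell$ on the first superdiagonal, and zeros elsewhere, and let $\Delta^\ell_Yp(Z^1,\dots,Z^\ell)$ be the top right block of $p(B(Z^1,\dots,Z^\ell))$. Let $$\mathcal I(Y)=\{p\in\Bbbk\langle x\rangle: p(Y)=0\},\qquad \mathcal I_\ell(Y)=\{p\in\Bbbk\langle x\rangle: p(B(Z^1,\dots,Z^\ell))=0\ \text{ for all } Z^1,\dots,Z^\ell\in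 M_s(\Bbbk)^g\},$$ so that $\mathcal I_0(Y)=\mathcal I(Y)$. Then: 1. $\mathcal I_\ell(Y)=\mathcal I(Y)^{\ell+1}$ for all $\ell\ge0$. 2. $\mathcal O_Y\cong\varprojlim_\ell \Bbbk\langle x\rangle/\mathcal I(Y)^\ell$ canonically: there is a $\Bbbk$-algebra isomorphism $\Phi:\mathcal O_Y\to\varprojlim_\ell\Bbbk\langle x\rangle/\mathcal I(Y)^\ell$ such that for all $f\in\mathcal O_Y$, $\ell\ge0$ and $p\in\Bbbk\langle x\rangle$, the $\ell$-th component of $\Phi(f)$ is the class of $p$ if and only if $f_m=\Delta^m_Yp$ for all $m<\ell$. In particular, $\Phi$ sends the germ $(\Delta^\ell_Yp)_\ell$ of a polynomial $p$ to the family of the classes of $p$. -/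

import Mathlib

namespace FreeAnalysis

/-! ### Sequences of multilinear maps with the convolution product -/

section Series

variable {k V A : Type*} [CommRing k] [AddCommGroup V] [Module k V] [Ring A] [Algebra k A]

variable (k V A) in
/-- Sequences `(f_ℓ)_{ℓ ≥ 0}` of `ℓ`-linear maps `f_ℓ : V^ℓ → A`. -/
def MultiSeq : Type _ := (ℓ : ℕ) → MultilinearMap k (fun _ : Fin ℓ => V) A

namespace MultiSeq

instance : AddCommGroup (MultiSeq k V A) :=
  inferInstanceAs (AddCommGroup ((ℓ : ℕ) → MultilinearMap k (fun _ : Fin ℓ => V) A))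

instance : Module k (MultiSeq k V A) :=
  inferInstanceAs (Module k ((ℓ : ℕ) → MultilinearMap k (fun _ : Fin ℓ => V) A))

/-- The `n`-linear map
`(Z^1, …, Z^n) ↦ f_i (Z^1, …, Z^i) * h_{n-i} (Z^{i+1}, …, Z^n)`. -/
def splitMul (f h : MultiSeq k V A) (n : ℕ) (i : Fin (n + 1)) :
    MultilinearMap k (fun _ : Fin n => V) A :=
  MultilinearMap.mk'
    (fun Z => f i (fun a : Fin i => Z ⟨a, by omega⟩) *
      h (n - i) (fun b : Fin (n - i) => Z ⟨i + b, by omega⟩))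
    (by
      intro Z m x y
      have hl : ∀ (hm : m.1 < i.1) (v : V),
          (fun a : Fin i => Function.update Z m v ⟨a, by omega⟩) =
            Function.update (fun a : Fin i => Z ⟨a, by omega⟩) ⟨m, hm⟩ v := by
        intro hm v; ext a; simp [Function.update_apply, Fin.ext_iff]
      have hl' : ∀ (hm : m.1 < i.1) (v : V),
          (fun b : Fin (n - i) => Function.update Z m v ⟨i + b, by omega⟩) =
            (fun b : Fin (n - i) => Z ⟨i + b, by omega⟩) := by
        intro hm v; ext b; rw [Function.update_of_ne]; simp [Fin.ext_iff]; omega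
      have hr : ∀ (_ : ¬ m.1 < i.1) (v : V),
          (fun a : Fin i => Function.update Z m v ⟨a, by omega⟩) =
            (fun a : Fin i => Z ⟨a, by omega⟩) := by
        intro hm v; ext a; rw [Function.update_of_ne]; simp [Fin.ext_iff]; omega
      have hr' : ∀ (hm : ¬ m.1 < i.1) (v : V),
          (fun b : Fin (n - i) => Function.update Z m v ⟨i + b, by omega⟩) =
            Function.update (fun b : Fin (n - i) => Z ⟨i + b, by omega⟩)
              ⟨m - i, by omega⟩ v := by
        intro hm v; ext b
        have : (i.1 + b.1 = m.1) ↔ b.1 = m.1 - i.1 := by omega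
        simp [Function.update_apply, Fin.ext_iff, this]
      by_cases hm : m.1 < i.1
      · simp only [hl hm, hl' hm, MultilinearMap.map_update_add, add_mul]
      · simp only [hr hm, hr' hm, MultilinearMap.map_update_add, mul_add])
    (by
      intro Z m c x
      have hl : ∀ (hm : m.1 < i.1) (v : V),
          (fun a : Fin i => Function.update Z m v ⟨a, by omega⟩) =
            Function.update (fun a : Fin i => Z ⟨a, by omega⟩) ⟨m, hm⟩ v := by
        intro hm v; ext a; simp [Function.update_apply, Fin.ext_iff]
      have hl' : ∀ (hm : m.1 < i.1) (v : V),
          (fun b : Fin (n - i) => Function.update Z m v ⟨i + b, by omega⟩) =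
            (fun b : Fin (n - i) => Z ⟨i + b, by omega⟩) := by
        intro hm v; ext b; rw [Function.update_of_ne]; simp [Fin.ext_iff]; omega
      have hr : ∀ (_ : ¬ m.1 < i.1) (v : V),
          (fun a : Fin i => Function.update Z m v ⟨a, by omega⟩) =
            (fun a : Fin i => Z ⟨a, by omega⟩) := by
        intro hm v; ext a; rw [Function.update_of_ne]; simp [Fin.ext_iff]; omega
      have hr' : ∀ (hm : ¬ m.1 < i.1) (v : V),
          (fun b : Fin (n - i) => Function.update Z m v ⟨i + b, by omega⟩) =
            Function.update (fun b : Fin (n - i) => Z ⟨i + b, by omega⟩)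
              ⟨m - i, by omega⟩ v := by
        intro hm v; ext b
        have : (i.1 + b.1 = m.1) ↔ b.1 = m.1 - i.1 := by omega
        simp [Function.update_apply, Fin.ext_iff, this]
      by_cases hm : m.1 < i.1
      · simp only [hl hm, hl' hm, MultilinearMap.map_update_smul, smul_mul_assoc]
      · simp only [hr hm, hr' hm, MultilinearMap.map_update_smul, mul_smul_comm])

/-- Convolution product:
`(f h)_n (Z^1, …, Z^n) = ∑_{i=0}^n f_i (Z^1, …, Z^i) h_{n-i} (Z^{i+1}, …, Z^n)`. -/
instance : Mul (MultiSeq k V A) := ⟨fun f h n => ∑ i : Fin (n + 1), splitMul f h n i⟩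

/-- The unit is the sequence `(1, 0, 0, …)`. -/
instance : One (MultiSeq k V A) :=
  ⟨fun ℓ => match ℓ with
    | 0 => MultilinearMap.constOfIsEmpty k (fun _ : Fin 0 => V) 1
    | _ + 1 => 0⟩

/-- Evaluation of `f_n` on the first `n` terms of an infinite sequence of vectors. -/
def app (f : MultiSeq k V A) (n : ℕ) (z : ℕ → V) : A := f n (fun i => z i)

theorem ext_app {f h : MultiSeq k V A} (H : ∀ n z, app f n z = app h n z) : f = h := by
  funext n
  ext Z
  have := H n (fun i => if hi : i < n then Z ⟨i, hi⟩ else 0)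
  simpa [app] using this

theorem app_add (f h : MultiSeq k V A) (n : ℕ) (z : ℕ → V) :
    app (f + h) n z = app f n z + app h n z := rfl

theorem app_zero (n : ℕ) (z : ℕ → V) : app (0 : MultiSeq k V A) n z = 0 := rfl

theorem app_smul (c : k) (f : MultiSeq k V A) (n : ℕ) (z : ℕ → V) :
    app (c • f) n z = c • app f n z := rfl

theorem app_one (n : ℕ) (z : ℕ → V) :
    app (1 : MultiSeq k V A) n z = if n = 0 then 1 else 0 := by
  cases n <;> rfl

theorem app_mul (f h : MultiSeq k V A) (n : ℕ) (z : ℕ → V) :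
    app (f * h) n z =
      ∑ i ∈ Finset.range (n + 1), app f i z * app h (n - i) (fun b => z (i + b)) := by
  rw [Finset.sum_range]
  change (∑ i : Fin (n + 1), splitMul f h n i) _ = _
  rw [_root_.sum_apply]
  rfl

theorem one_mul' (f : MultiSeq k V A) : 1 * f = f := by
  refine ext_app fun n z => ?_
  rw [app_mul, Finset.sum_eq_single 0]
  · simp [app_one]
  · intro b _ hb; simp [app_one, hb]
  · simp

theorem mul_one' (f : MultiSeq k V A) : f * 1 = f := by
  refine ext_app fun n z => ?_
  rw [app_mul, Finset.sum_eq_single n]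
  · simp [app_one]
  · intro b hb hb'
    have : n - b ≠ 0 := by have := Finset.mem_range.1 hb; omega
    simp [app_one, this]
  · simp

theorem mul_assoc' (f h l : MultiSeq k V A) : f * h * l = f * (h * l) := by
  refine ext_app fun n z => ?_
  simp only [app_mul, Finset.sum_mul, Finset.mul_sum]
  rw [Finset.sum_sigma', Finset.sum_sigma']
  refine Finset.sum_bij' (fun x _ => ⟨x.2, x.1 - x.2⟩) (fun x _ => ⟨x.1 + x.2, x.1⟩)
    ?_ ?_ ?_ ?_ ?_
  · rintro ⟨i, j⟩ hx
    simp only [Finset.mem_sigma, Finset.mem_range] at hx ⊢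
    omega
  · rintro ⟨i, j⟩ hx
    simp only [Finset.mem_sigma, Finset.mem_range] at hx ⊢
    omega
  · rintro ⟨i, j⟩ hx
    simp only [Finset.mem_sigma, Finset.mem_range] at hx
    have : j + (i - j) = i := by omega
    simp [this]
  · rintro ⟨i, j⟩ hx
    simp
  · rintro ⟨i, j⟩ hx
    simp only [Finset.mem_sigma, Finset.mem_range] at hx
    have h1 : n - j - (i - j) = n - i := by omega
    have h2 : ∀ b, j + (i - j + b) = i + b := by intro b; omega
    simp only [h1, h2, mul_assoc]

instance : Ring (MultiSeq k V A) :=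
  { (inferInstance : AddCommGroup (MultiSeq k V A)) with
    mul := (· * ·)
    one := 1
    one_mul := one_mul'
    mul_one := mul_one'
    mul_assoc := mul_assoc'
    left_distrib := fun f h l => ext_app fun n z => by
      simp only [app_mul, app_add, mul_add, Finset.sum_add_distrib]
    right_distrib := fun f h l => ext_app fun n z => by
      simp only [app_mul, app_add, add_mul, Finset.sum_add_distrib]
    zero_mul := fun f => ext_app fun n z => by simp [app_mul, app_zero]
    mul_zero := fun f => ext_app fun n z => by simp [app_mul, app_zero] }

instance : Algebra k (MultiSeq k V A) :=
  Algebra.ofModule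
    (fun c f h => ext_app fun n z => by
      simp only [app_mul, app_smul, Finset.smul_sum, smul_mul_assoc])
    (fun c f h => ext_app fun n z => by
      simp only [app_mul, app_smul, Finset.smul_sum, mul_smul_comm])

end MultiSeq

end Series

/-! ### Matrix points -/

section Points

variable {k : Type*} [Field k] {g s : ℕ}

variable (k g s) in
/-- `g`-tuples of `s × s` matrices over `k`. -/
abbrev Point : Type _ := Fin g → Matrix (Fin s) (Fin s) k

/-- `Y` is semisimple: every subspace of `k^s` that is invariant under all `Y_j` has a
complementary subspace that is invariant under all `Y_j`. -/
def IsSemisimplePoint (Y : Point k g s) : Prop :=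
  ∀ W : Submodule k (Fin s → k), (∀ j, ∀ w ∈ W, (Y j).mulVec w ∈ W) →
    ∃ W' : Submodule k (Fin s → k), (∀ j, ∀ w ∈ W', (Y j).mulVec w ∈ W') ∧ IsCompl W W'

/-- `[S, Y] = (S Y_j - Y_j S)_j`. -/
def comm (S : Matrix (Fin s) (Fin s) k) (Y : Point k g s) : Point k g s :=
  fun j => S * Y j - Y j * S

/-- `S Z = (S Z_j)_j`. -/
def lmul (S : Matrix (Fin s) (Fin s) k) (Z : Point k g s) : Point k g s := fun j => S * Z j

/-- `Z S = (Z_j S)_j`. -/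
def rmul (Z : Point k g s) (S : Matrix (Fin s) (Fin s) k) : Point k g s := fun j => Z j * S

/-- The intertwining conditions `LAC(Y)` with respect to `Y`. In `middle`, the commutator is placed between
two consecutive arguments `Z j.castSucc` and `Z j.succ`. -/
structure LAC (Y : Point k g s) (f : MultiSeq k (Point k g s) (Matrix (Fin s) (Fin s) k)) :
    Prop where
  one : ∀ S : Matrix (Fin s) (Fin s) k, f 1 ![comm S Y] = S * f 0 ![] - f 0 ![] * S
  first : ∀ (n : ℕ) (S : Matrix (Fin s) (Fin s) k) (Z : Fin (n + 1) → Point k g s),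
    f (n + 2) (Fin.cons (comm S Y) Z) =
      S * f (n + 1) Z - f (n + 1) (Function.update Z 0 (lmul S (Z 0)))
  middle : ∀ (n : ℕ) (j : Fin n) (S : Matrix (Fin s) (Fin s) k) (Z : Fin (n + 1) → Point k g s),
    f (n + 2) (j.succ.castSucc.insertNth (comm S Y) Z) =
      f (n + 1) (Function.update Z j.castSucc (rmul (Z j.castSucc) S)) -
        f (n + 1) (Function.update Z j.succ (lmul S (Z j.succ)))
  last : ∀ (n : ℕ) (S : Matrix (Fin s) (Fin s) k) (Z : Fin (n + 1) → Point k g s),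
    f (n + 2) (Fin.snoc Z (comm S Y)) =
      f (n + 1) (Function.update Z (Fin.last n) (rmul (Z (Fin.last n)) S)) - f (n + 1) Z * S

/-- Insert `v` at position `p` of the sequence `z`. -/
def ins {V : Type*} (p : ℕ) (v : V) (z : ℕ → V) : ℕ → V :=
  fun i => if i < p then z i else if i = p then v else z (i - 1)

/-- The conditions `LAC(Y)`, written uniformly in terms of infinite sequences of arguments. -/
theorem lac_iff_app (Y : Point k g s)
    (f : MultiSeq k (Point k g s) (Matrix (Fin s) (Fin s) k)) :
    LAC Y f ↔ ∀ (n p : ℕ) (_ : p ≤ n) (S : Matrix (Fin s) (Fin s) k) (z : ℕ → Point k g s),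
      f.app (n + 1) (ins p (comm S Y) z) =
        (if p = 0 then S * f.app n z
          else f.app n (Function.update z (p - 1) (rmul (z (p - 1)) S))) -
        (if p = n then f.app n z * S
          else f.app n (Function.update z p (lmul S (z p)))) := by
  have hupd : ∀ (n : ℕ) (j : Fin n) (z : ℕ → Point k g s) (v : Point k g s),
      (fun i : Fin n => Function.update z j.1 v i.1) =
        Function.update (fun i : Fin n => z i) j v := by
    intro n j z v; funext i; simp [Function.update_apply, Fin.ext_iff]
  have hcons : ∀ (n : ℕ) (z : ℕ → Point k g s) (v : Point k g s),
      (fun i : Fin (n + 1) => ins 0 v z i.1) = Fin.cons v (fun i : Fin n => z i) := by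
    intro n z v; funext i; refine Fin.cases ?_ (fun i => ?_) i <;> simp [ins]
  have hsnoc : ∀ (n : ℕ) (z : ℕ → Point k g s) (v : Point k g s),
      (fun i : Fin (n + 1) => ins n v z i.1) = Fin.snoc (fun i : Fin n => z i) v := by
    intro n z v; funext i; refine Fin.lastCases ?_ (fun i => ?_) i <;> simp [ins]
  have hins : ∀ (n : ℕ) (j : Fin n) (z : ℕ → Point k g s) (v : Point k g s),
      (fun i : Fin (n + 2) => ins (j.1 + 1) v z i.1) =
        j.succ.castSucc.insertNth v (fun i : Fin (n + 1) => z i) := by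
    intro n j z v
    rw [Fin.eq_insertNth_iff]
    refine ⟨by simp [ins], ?_⟩
    funext i
    by_cases h : i.1 < j.1 + 1
    · have : j.succ.castSucc.succAbove i = i.castSucc :=
        Fin.succAbove_of_castSucc_lt _ _ (by simpa [Fin.lt_def] using h)
      change ins (j.1 + 1) v z (j.succ.castSucc.succAbove i).1 = z i
      rw [this]
      simp only [ins, Fin.val_castSucc, if_pos h]
    · have : j.succ.castSucc.succAbove i = i.succ :=
        Fin.succAbove_of_le_castSucc _ _ (by simp [Fin.le_def]; omega)
      have h1 : ¬ (i.1 < j.1) := by omega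
      have h2 : ¬ (i.1 = j.1) := by omega
      change ins (j.1 + 1) v z (j.succ.castSucc.succAbove i).1 = z i
      rw [this]
      simp [ins, h1, h2]
  have hext : ∀ (n : ℕ) (Z : Fin n → Point k g s),
      ∃ z : ℕ → Point k g s, Z = fun i : Fin n => z i := by
    intro n Z
    exact ⟨fun i => if hi : i < n then Z ⟨i, hi⟩ else 0, by funext i; simp⟩
  constructor
  · intro h n p hp S z
    rcases n with _ | n
    · obtain rfl : p = 0 := by omega
      have := h.one S
      simp only [MultiSeq.app, if_true]
      convert this using 2
      · rw [hcons]; funext i; fin_cases i; rfl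
      · congr 2; exact Subsingleton.elim _ _
      · congr 2; exact Subsingleton.elim _ _
    · rcases p with _ | p
      · have := h.first n S (fun i => z i)
        have hu := hupd (n + 1) 0 z (lmul S (z 0))
        simp only [Fin.val_zero] at hu this
        simp [MultiSeq.app, hcons, this, hu]
      · by_cases hpn : p = n
        · subst hpn
          have := h.last p S (fun i => z i)
          have hu := hupd (p + 1) (Fin.last p) z (rmul (z p) S)
          simp only [Fin.val_last] at hu this
          simp [MultiSeq.app, hsnoc, this, hu]
        · have hlt : p < n := by omega
          have := h.middle n ⟨p, hlt⟩ S (fun i => z i)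
          have hi := hins n ⟨p, hlt⟩ z (comm S Y)
          have hu := hupd (n + 1) (Fin.castSucc ⟨p, hlt⟩) z (rmul (z p) S)
          have hu' := hupd (n + 1) (Fin.succ ⟨p, hlt⟩) z (lmul S (z (p + 1)))
          simp only [Fin.val_castSucc, Fin.val_succ] at hi hu hu' this
          simp only [MultiSeq.app, Nat.add_sub_cancel, hi, this, hu, hu']
          simp [hpn]
  · intro h
    refine ⟨fun S => ?_, fun n S Z => ?_, fun n j S Z => ?_, fun n S Z => ?_⟩
    · have := h 0 0 le_rfl S (fun _ => 0)
      simp only [MultiSeq.app, if_true] at this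
      convert this using 2
      · rw [hcons]; funext i; fin_cases i; rfl
      · congr 2; exact Subsingleton.elim _ _
      · congr 2; exact Subsingleton.elim _ _
    · obtain ⟨z, rfl⟩ := hext _ Z
      have := h (n + 1) 0 (by omega) S z
      have hu := hupd (n + 1) 0 z (lmul S (z 0))
      simp only [Fin.val_zero] at hu
      simpa [MultiSeq.app, hcons, hu] using this
    · obtain ⟨z, rfl⟩ := hext _ Z
      have := h (n + 1) (j.1 + 1) (by omega) S z
      have hi := hins n j z (comm S Y)
      have hu := hupd (n + 1) (Fin.castSucc j) z (rmul (z j) S)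
      have hu' := hupd (n + 1) (Fin.succ j) z (lmul S (z (j + 1)))
      simp only [Fin.val_castSucc, Fin.val_succ] at hu hu'
      have hj : j.1 ≠ n := by omega
      simpa [MultiSeq.app, hi, hu, hu', hj] using this
    · obtain ⟨z, rfl⟩ := hext _ Z
      have := h (n + 1) (n + 1) le_rfl S z
      have hu := hupd (n + 1) (Fin.last n) z (rmul (z n) S)
      simp only [Fin.val_last] at hu
      simpa [MultiSeq.app, hsnoc, hu] using this

theorem LAC.mul {Y : Point k g s}
    {f h : MultiSeq k (Point k g s) (Matrix (Fin s) (Fin s) k)} (hf : LAC Y f) (hh : LAC Y h) :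
    LAC Y (f * h) := by
  rw [lac_iff_app] at *
  intro n p hp S z
  obtain ⟨q, rfl⟩ := Nat.exists_eq_add_of_le hp
  have hcong : ∀ (u : MultiSeq k (Point k g s) (Matrix (Fin s) (Fin s) k)) (m : ℕ)
      (y y' : ℕ → Point k g s), (∀ i < m, y i = y' i) → u.app m y = u.app m y' := by
    intro u m y y' H
    unfold MultiSeq.app
    congr 1
    funext i
    exact H i i.2
  have hU1 : ∀ (m r : ℕ) (v : Point k g s), m ≤ r →
      f.app m (Function.update z r v) = f.app m z := by
    intro m r v hm
    refine hcong _ _ _ _ fun i hi => ?_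
    rw [Function.update_of_ne]; omega
  have hU2 : ∀ (m r : ℕ) (v : Point k g s), r < m →
      (fun b => Function.update z r v (m + b)) = fun b => z (m + b) := by
    intro m r v hm
    funext b
    rw [Function.update_of_ne]; omega
  have hU3 : ∀ (m r : ℕ) (v : Point k g s), m ≤ r →
      (fun b => Function.update z r v (m + b)) =
        Function.update (fun b => z (m + b)) (r - m) v := by
    intro m r v hm
    funext b
    have : m + b = r ↔ b = r - m := by omega
    simp [Function.update_apply, this]
  have hI1 : ∀ (m : ℕ) (v : Point k g s), m ≤ p → f.app m (ins p v z) = f.app m z := by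
    intro m v hm
    refine hcong _ _ _ _ fun i hi => ?_
    have : i < p := by omega
    simp [ins, this]
  have hI2 : ∀ (m : ℕ) (v : Point k g s), m ≤ p →
      (fun b => ins p v z (m + b)) = ins (p - m) v (fun b => z (m + b)) := by
    intro m v hm
    funext b
    unfold ins
    have e1 : m + b < p ↔ b < p - m := by omega
    have e2 : m + b = p ↔ b = p - m := by omega
    simp only [e1, e2]
    split_ifs with h1 h2
    · rfl
    · rfl
    · congr 1; omega
  have hI3 : ∀ (x : ℕ) (v : Point k g s),
      (fun b => ins p v z (p + 1 + x + b)) = fun b => z (p + x + b) := by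
    intro x v
    funext b
    unfold ins
    rw [if_neg (by omega), if_neg (by omega)]
    congr 1; omega
  set c := comm S Y with hc
  -- left-hand side
  have hL : (f * h).app (p + q + 1) (ins p c z) =
      (∑ i ∈ Finset.range p, f.app i z *
          (h.app (p + q - i)
            (Function.update (fun b => z (i + b)) (p - 1 - i) (rmul (z (p - 1)) S)) -
          (if p = p + q then h.app (p + q - i) (fun b => z (i + b)) * S
            else h.app (p + q - i)
              (Function.update (fun b => z (i + b)) (p - i) (lmul S (z p))))) +
        f.app p z * (S * h.app q (fun b => z (p + b)) -
          (if p = p + q then h.app (p + q - p) (fun b => z (p + b)) * S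
            else h.app (p + q - p)
              (Function.update (fun b => z (p + b)) (p - p) (lmul S (z p)))))) +
      (∑ x ∈ Finset.range (q + 1),
        ((if p = 0 then S * f.app (p + x) z
            else f.app (p + x) (Function.update z (p - 1) (rmul (z (p - 1)) S))) -
          (if x = 0 then f.app (p + x) z * S
            else f.app (p + x) (Function.update z p (lmul S (z p))))) *
          h.app (q - x) (fun b => z (p + x + b))) := by
    rw [MultiSeq.app_mul, show p + q + 1 + 1 = (p + 1) + (q + 1) by omega,
      Finset.sum_range_add, Finset.sum_range_succ]
    congr 1
    · congr 1
      · refine Finset.sum_congr rfl fun i hi => ?_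
        have hi := Finset.mem_range.1 hi
        rw [hI1 _ _ hi.le, hI2 _ _ hi.le, show p + q + 1 - i = (p + q - i) + 1 by omega,
          hh (p + q - i) (p - i) (by omega)]
        have e1 : ¬ (p - i = 0) := by omega
        have e2 : (p - i = p + q - i) ↔ p = p + q := by omega
        have e3 : i + (p - i - 1) = p - 1 := by omega
        have e4 : i + (p - i) = p := by omega
        have e5 : p - i - 1 = p - 1 - i := by omega
        simp only [e1, if_false, e2, e3, e4]
        rw [e5]
      · rw [hI1 _ _ le_rfl, hI2 _ _ le_rfl, show p + q + 1 - p = q + 1 by omega,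
          show p - p = 0 by omega, hh q 0 (by omega)]
        have e2 : (0 = q) ↔ p = p + q := by omega
        have e3 : p + q - p = q := by omega
        simp only [e2, e3, if_true, add_zero]
    · refine Finset.sum_congr rfl fun x hx => ?_
      rw [hI3, show p + 1 + x = (p + x) + 1 by omega, hf (p + x) p (by omega),
        show p + q + 1 - (p + x + 1) = q - x by omega]
      have e2 : (p = p + x) ↔ x = 0 := by omega
      simp only [e2]
  have hR1 : (if p = 0 then S * (f * h).app (p + q) z
        else (f * h).app (p + q) (Function.update z (p - 1) (rmul (z (p - 1)) S))) =
      (∑ i ∈ Finset.range p, f.app i z * h.app (p + q - i)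
        (Function.update (fun b => z (i + b)) (p - 1 - i) (rmul (z (p - 1)) S))) +
      (∑ x ∈ Finset.range (q + 1),
        (if p = 0 then S * f.app (p + x) z
            else f.app (p + x) (Function.update z (p - 1) (rmul (z (p - 1)) S))) *
          h.app (q - x) (fun b => z (p + x + b))) := by
    by_cases h0 : p = 0
    · subst h0
      simp [MultiSeq.app_mul, Finset.mul_sum, mul_assoc]
    · simp only [if_neg h0]
      rw [MultiSeq.app_mul, show p + q + 1 = p + (q + 1) by omega, Finset.sum_range_add]
      congr 1
      · refine Finset.sum_congr rfl fun i hi => ?_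
        have hi := Finset.mem_range.1 hi
        rw [hU1 _ _ _ (by omega), hU3 _ _ _ (by omega)]
      · refine Finset.sum_congr rfl fun x hx => ?_
        rw [hU2 _ _ _ (by omega), show p + q - (p + x) = q - x by omega]
  have hR2 : (if p = p + q then (f * h).app (p + q) z * S
        else (f * h).app (p + q) (Function.update z p (lmul S (z p)))) =
      (∑ i ∈ Finset.range (p + 1), f.app i z *
          (if p = p + q then h.app (p + q - i) (fun b => z (i + b)) * S
            else h.app (p + q - i)
              (Function.update (fun b => z (i + b)) (p - i) (lmul S (z p))))) +
      (∑ x ∈ Finset.range q, f.app (p + (x + 1)) (Function.update z p (lmul S (z p))) *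
          h.app (q - (x + 1)) (fun b => z (p + (x + 1) + b))) := by
    by_cases h0 : q = 0
    · subst h0
      simp [MultiSeq.app_mul, Finset.sum_mul, mul_assoc]
    · have h1 : ¬ (p = p + q) := by omega
      simp only [if_neg h1]
      rw [MultiSeq.app_mul, show p + q + 1 = (p + 1) + q by omega, Finset.sum_range_add]
      congr 1
      · refine Finset.sum_congr rfl fun i hi => ?_
        have hi := Finset.mem_range.1 hi
        rw [hU1 _ _ _ (by omega), hU3 _ _ _ (by omega)]
      · refine Finset.sum_congr rfl fun x hx => ?_
        rw [hU2 _ _ _ (by omega), show p + q - (p + 1 + x) = q - (x + 1) by omega,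
          show p + 1 + x = p + (x + 1) by omega]
  rw [hL, hR1, hR2, Finset.sum_range_succ (n := p)]
  simp only [sub_mul, mul_sub, Finset.sum_sub_distrib]
  rw [Finset.sum_range_succ' (fun x => (if x = 0 then f.app (p + x) z * S
    else f.app (p + x) (Function.update z p (lmul S (z p)))) *
      h.app (q - x) (fun b => z (p + x + b)))]
  simp only [Nat.add_eq_zero_iff, one_ne_zero, and_false, if_false, if_true, add_zero,
    Nat.sub_zero, mul_assoc]
  abel

theorem lac_add {Y : Point k g s}
    {f h : MultiSeq k (Point k g s) (Matrix (Fin s) (Fin s) k)} (hf : LAC Y f) (hh : LAC Y h) :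
    LAC Y (f + h) := by
  rw [lac_iff_app] at *
  intro n p hp S z
  simp only [MultiSeq.app_add, hf n p hp S z, hh n p hp S z]
  split_ifs <;> simp only [mul_add, add_mul, add_sub_add_comm]

theorem lac_algebraMap (Y : Point k g s) (c : k) :
    LAC Y (algebraMap k (MultiSeq k (Point k g s) (Matrix (Fin s) (Fin s) k)) c) := by
  rw [Algebra.algebraMap_eq_smul_one, lac_iff_app]
  intro n p hp S z
  rcases Nat.eq_zero_or_pos n with rfl | hn
  · obtain rfl : p = 0 := by omega
    simp [MultiSeq.app_smul, MultiSeq.app_one]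
  · have : n ≠ 0 := by omega
    simp [MultiSeq.app_smul, MultiSeq.app_one, this]

/-- The `k`-algebra of formal nc germs about `Y`: sequences of multilinear maps that satisfy
`LAC(Y)`, with termwise addition and the convolution product. -/
def formalGerms (Y : Point k g s) :
    Subalgebra k (MultiSeq k (Point k g s) (Matrix (Fin s) (Fin s) k)) where
  carrier := {f | LAC Y f}
  mul_mem' := LAC.mul
  add_mem' := lac_add
  algebraMap_mem' := lac_algebraMap Y

/-! ### The free algebra: vanishing ideals, differentials, completion -/

/-- The block matrix with `ℓ + 1` diagonal blocks `Y_j`, the blocks `Z^1_j, …, Z^ℓ_j` directly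
above the diagonal, and zero blocks elsewhere. -/
def blockBidiag (Y : Point k g s) {ℓ : ℕ} (Z : Fin ℓ → Point k g s) (j : Fin g) :
    Matrix (Fin (ℓ + 1)) (Fin (ℓ + 1)) (Matrix (Fin s) (Fin s) k) :=
  Matrix.of fun a b =>
    if a = b then Y j
    else if h : a.1 + 1 = b.1 then Z ⟨a, by omega⟩ j
    else 0

/-- Evaluation of nc polynomials at the `g`-tuple of block matrices `blockBidiag Y Z`. -/
noncomputable def blockEval (Y : Point k g s) {ℓ : ℕ} (Z : Fin ℓ → Point k g s) :
    FreeAlgebra k (Fin g) →ₐ[k]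
      Matrix (Fin (ℓ + 1)) (Fin (ℓ + 1)) (Matrix (Fin s) (Fin s) k) :=
  FreeAlgebra.lift k (blockBidiag Y Z)

/-- The `ℓ`-th nc differential `Δ^ℓ_Y p (Z^1, …, Z^ℓ)` of an nc polynomial `p`: the top right
block of `p` evaluated at `blockBidiag Y Z`. -/
noncomputable def ncDiff (Y : Point k g s) (p : FreeAlgebra k (Fin g)) (ℓ : ℕ)
    (Z : Fin ℓ → Point k g s) : Matrix (Fin s) (Fin s) k :=
  blockEval Y Z p 0 (Fin.last ℓ)

/-- The vanishing ideal `I(Y) = {p | p(Y) = 0}` in the free algebra. -/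
noncomputable def vanishingIdeal (Y : Point k g s) : Ideal (FreeAlgebra k (Fin g)) :=
  RingHom.ker (FreeAlgebra.lift k Y)

instance (Y : Point k g s) : (vanishingIdeal Y).IsTwoSided :=
  inferInstanceAs (RingHom.ker (FreeAlgebra.lift k Y)).IsTwoSided

/-- The ideal `I_ℓ(Y)` of all nc polynomials that vanish at the block matrices `blockBidiag Y Z`
for all `Z^1, …, Z^ℓ`. -/
noncomputable def higherVanishingIdeal (Y : Point k g s) (ℓ : ℕ) :
    Ideal (FreeAlgebra k (Fin g)) :=
  ⨅ Z : Fin ℓ → Point k g s, RingHom.ker (blockEval Y Z)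

/-- The inverse limit `lim_ℓ R / I^ℓ` of the quotients of a `k`-algebra `R` by the powers of a
two-sided ideal `I`, as the algebra of compatible families. -/
def powerCompletion {R : Type*} [Ring R] [Algebra k R] (I : Ideal R) [I.IsTwoSided] :
    Subalgebra k ((ℓ : ℕ) → R ⧸ I ^ ℓ) where
  carrier := {x | ∀ (m n : ℕ) (h : m ≤ n),
    Ideal.Quotient.factor (Ideal.pow_le_pow_right h) (x n) = x m}
  mul_mem' hx hy m n h := by simp only [Pi.mul_apply, map_mul, hx m n h, hy m n h]
  add_mem' hx hy m n h := by simp only [Pi.add_apply, map_add, hx m n h, hy m n h]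
  algebraMap_mem' _ _ _ _ := rfl

end Points

end FreeAnalysis

/-!
Extend a sequence `f` of multilinear maps to block matrices and let `f(T) = ∑ f_n(T, …, T)` for
tuples `T` of block matrices that are nilpotent over the tensor algebra. By telescoping, the
relations of a germ say that `R f(T) = f(T') R` whenever `R` intertwines the perturbations
`Y ⊕ ⋯ ⊕ Y + T` and `Y ⊕ ⋯ ⊕ Y + T'`. Write `I` for the vanishing ideal of `Y`. As `Y` is
semisimple, every finite-dimensional module over the free algebra annihilated by `I ^ ℓ` embeds
into the module of such a perturbation with vanishing `ℓ`-th power: filter it by `I` and split the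
semisimple layers. The quotient of the free algebra by `I ^ ℓ` is one of these modules, since
`I ^ ℓ` has finite codimension, and hence a polynomial whose differentials of order less than `ℓ`
at `Y` vanish lies in `I ^ ℓ`. For a germ `f`, embedding the quotients of the module of a
perturbation in the same way shows that `f(T)` preserves every submodule, so that on each vector
it agrees with some polynomial; applied to a vector with annihilator in `I ^ ℓ`, together with any
other vector, this yields one polynomial that agrees with `f` up to order `ℓ`.
-/

namespace FreeAnalysis

open Finset Matrix

theorem sum_range_sub_eq_of_square {M : Type*} [AddCommGroup M] (α β : ℕ → ℕ → M)
    (h : ∀ i j, α (i + 1) j - α i j = β i (j + 1) - β i j) (N : ℕ) :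
    ∑ j ∈ range N, (α N j - α 0 j) = ∑ i ∈ range N, (β i N - β i 0) := by
  calc ∑ j ∈ range N, (α N j - α 0 j)
      = ∑ j ∈ range N, ∑ i ∈ range N, (α (i + 1) j - α i j) :=
        sum_congr rfl fun j _ => (sum_range_sub (α · j) N).symm
    _ = ∑ i ∈ range N, ∑ j ∈ range N, (β i (j + 1) - β i j) := by
      rw [sum_comm]
      simp only [h]
    _ = ∑ i ∈ range N, (β i N - β i 0) := sum_congr rfl fun i _ => sum_range_sub (β i) N

theorem smul_eq_zero_of_mem_smul_top {R M : Type*} [Ring R] [AddCommGroup M] [Module R M]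
    {I J : Ideal R} (h : ∀ r ∈ I * J, ∀ x : M, r • x = 0) {r : R} (hr : r ∈ I) {x : M}
    (hx : x ∈ J • (⊤ : Submodule R M)) : r • x = 0 := by
  induction hx using Submodule.smul_induction_on' with
  | smul q hq y _ => rw [← mul_smul, h _ (Ideal.mul_mem_mul hr hq)]
  | add y _ z _ hy hz => rw [smul_add, hy, hz, add_zero]

theorem exists_comp_eq_of_ker_le_ker {K U V W : Type*} [Field K] [AddCommGroup U] [Module K U]
    [AddCommGroup V] [Module K V] [AddCommGroup W] [Module K W] {φ : U →ₗ[K] V} {ψ : U →ₗ[K] W}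
    (h : LinearMap.ker φ ≤ LinearMap.ker ψ) : ∃ β : V →ₗ[K] W, β ∘ₗ φ = ψ := by
  obtain ⟨σ, hσ⟩ := LinearMap.exists_leftInverse_of_injective ((LinearMap.ker φ).liftQ φ le_rfl)
    (Submodule.ker_liftQ_eq_bot _ _ _ le_rfl)
  refine ⟨(LinearMap.ker φ).liftQ ψ h ∘ₗ σ, LinearMap.ext fun u => ?_⟩
  exact congrArg ((LinearMap.ker φ).liftQ ψ h)
    (LinearMap.congr_fun hσ (Submodule.Quotient.mk u))

/-! ### Ideals of finite codimension and completions -/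

section

variable {k R : Type*} [Field k] [Ring R] [Algebra k R]

theorem eq_top_of_one_mem_of_generators_mul_mem {X : Set R} (hX : Algebra.adjoin k X = ⊤)
    {M : Submodule k R} (one_mem : 1 ∈ M) (mul_mem : ∀ x ∈ X, ∀ m ∈ M, x * m ∈ M) : M = ⊤ := by
  have key (r : R) (hr : r ∈ Algebra.adjoin k X) : ∀ m ∈ M, r * m ∈ M := by
    induction hr using Algebra.adjoin_induction with
    | mem x hx => exact mul_mem x hx
    | algebraMap c => exact fun m hm => Algebra.smul_def c m ▸ M.smul_mem c hm
    | add a b _ _ ha hb => exact fun m hm => add_mul a b m ▸ M.add_mem (ha m hm) (hb m hm)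
    | mul a b _ _ ha hb => exact fun m hm => mul_assoc a b m ▸ ha _ (hb m hm)
  exact eq_top_iff.2 fun r _ => mul_one r ▸ key r (hX ▸ Algebra.mem_top) 1 one_mem

-- Schreier's argument: `B` contains representatives of `R ⧸ L`, and `L` is generated by those of
-- its elements that are combinations of products of a generator and a representative.
theorem fg_of_cofg_restrictScalars [Algebra.FiniteType k R] {L : Ideal R}
    (hL : (L.restrictScalars k).CoFG) : L.FG := by
  obtain ⟨X, hX⟩ := Algebra.FiniteType.out (R := k) (A := R)
  obtain ⟨C, hC⟩ := exists_isCompl (L.restrictScalars k)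
  set B : Submodule k R := C ⊔ Submodule.span k {1}
  have one_mem_B : 1 ∈ B := Submodule.mem_sup_right (Submodule.mem_span_singleton_self 1)
  have exists_add (r : R) : ∃ b ∈ B, ∃ l ∈ L, b + l = r := by
    obtain ⟨l, hl, c, hc, h⟩ := Submodule.mem_sup.1 (hC.sup_eq_top ▸ Submodule.mem_top (x := r))
    exact ⟨c, Submodule.mem_sup_left hc, l, hl, add_comm c l ▸ h⟩
  set G : Submodule k R := Submodule.span k (insert 1 X) * B
  have mul_mem_G {x b : R} (hx : x ∈ insert 1 (X : Set R)) (hb : b ∈ B) : x * b ∈ G :=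
    Submodule.mul_mem_mul (Submodule.subset_span hx) hb
  have hBG : B ≤ G := fun b hb => one_mul b ▸ mul_mem_G (Set.mem_insert 1 _) hb
  have hG : G.FG := (Submodule.fg_span (X.finite_toSet.insert 1)).mul
    ((hL.fg_of_isCompl hC).sup (Submodule.fg_span_singleton 1))
  obtain ⟨J, hJ⟩ : (G ⊓ L.restrictScalars k).FG := hG.of_le inf_le_left
  set L' : Ideal R := Submodule.span R J
  have mem_L' {l : R} (hl : l ∈ L) (hlG : l ∈ G) : l ∈ L' :=
    Submodule.span_le_restrictScalars k R (J : Set R) (hJ ▸ ⟨hlG, hl⟩)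
  have hL' : L' ≤ L := Submodule.span_le.2 fun l hl =>
    (hJ ▸ Submodule.subset_span hl : l ∈ G ⊓ L.restrictScalars k).2
  have sup_eq_top : B ⊔ L'.restrictScalars k = ⊤ := by
    refine eq_top_of_one_mem_of_generators_mul_mem hX (Submodule.mem_sup_left one_mem_B)
      fun x hx m hm => ?_
    obtain ⟨b, hb, l, hl, rfl⟩ := Submodule.mem_sup.1 hm
    obtain ⟨b', hb', l', hl', h⟩ := exists_add (x * b)
    have hlG : l' ∈ G := eq_sub_of_add_eq' h ▸
      G.sub_mem (mul_mem_G (Set.mem_insert_of_mem 1 hx) hb) (hBG hb')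
    rw [mul_add, ← h, add_assoc]
    exact Submodule.add_mem_sup hb' (L'.add_mem (mem_L' hl' hlG) (L'.mul_mem_left x hl))
  refine ⟨J, le_antisymm hL' fun l hl => ?_⟩
  obtain ⟨b, hb, l', hl', rfl⟩ := Submodule.mem_sup.1 (sup_eq_top ▸ Submodule.mem_top (x := l))
  have hbL : b ∈ L := (L.add_mem_iff_left (hL' hl')).1 hl
  exact L'.add_mem (mem_L' hbL (hBG hb)) hl'

theorem cofg_restrictScalars_mul [Algebra.FiniteType k R] {I L : Ideal R}
    (hI : (I.restrictScalars k).CoFG) (hL : (L.restrictScalars k).CoFG) :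
    ((I * L).restrictScalars k).CoFG := by
  obtain ⟨A, hA⟩ := fg_of_cofg_restrictScalars hL
  obtain ⟨B, hB⟩ := exists_isCompl (I.restrictScalars k)
  obtain ⟨C, hC⟩ := exists_isCompl (L.restrictScalars k)
  have hD : (C ⊔ B * Submodule.span k A).FG :=
    (hL.fg_of_isCompl hC).sup ((hI.fg_of_isCompl hB).mul (Submodule.fg_span A.finite_toSet))
  refine hD.cofg_of_codisjoint (codisjoint_iff_le_sup.2 ?_)
  have mul_mem (r : R) {a : R} (ha : a ∈ A) :
      r * a ∈ B * Submodule.span k A ⊔ (I * L).restrictScalars k := by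
    obtain ⟨i, hi, b, hb, rfl⟩ := Submodule.mem_sup.1 (hB.sup_eq_top ▸ Submodule.mem_top (x := r))
    rw [add_mul, add_comm]
    exact Submodule.add_mem_sup (Submodule.mul_mem_mul hb (Submodule.subset_span ha))
      (Ideal.mul_mem_mul hi (hA ▸ Submodule.subset_span ha))
  rw [← hC.sup_eq_top, sup_comm, sup_assoc]
  refine sup_le_sup_left (fun l hl => ?_) C
  obtain ⟨c, -, rfl⟩ := Submodule.mem_span_finset.1 (hA.ge hl)
  exact Submodule.sum_mem _ fun a ha => mul_mem (c a) ha

theorem cofg_restrictScalars_pow [Algebra.FiniteType k R] {I : Ideal R}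
    (hI : (I.restrictScalars k).CoFG) (n : ℕ) : ((I ^ n).restrictScalars k).CoFG := by
  induction n with
  | zero => rw [Submodule.pow_zero, Ideal.one_eq_top]; exact Submodule.CoFG.top
  | succ n ih => exact cofg_restrictScalars_mul ih hI

theorem exists_algEquiv_powerCompletion {O : Type*} [Ring O] [Algebra k O]
    (I : Ideal R) [I.IsTwoSided] (ψ : R →ₐ[k] O) (J : ℕ → Ideal O) [∀ ℓ, (J ℓ).IsTwoSided]
    (antitone : Antitone J) (comap_eq : ∀ ℓ, (J ℓ).comap ψ = I ^ ℓ)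
    (dense : ∀ ℓ f, ∃ p, f - ψ p ∈ J ℓ) (separated : ⨅ ℓ, J ℓ = ⊥)
    (complete : ∀ p : ℕ → R, (∀ m n, m ≤ n → p n - p m ∈ I ^ m) → ∃ f, ∀ ℓ, f - ψ (p ℓ) ∈ J ℓ) :
    ∃ Φ : O ≃ₐ[k] powerCompletion (k := k) I, ∀ f ℓ p,
      (Φ f).1 ℓ = Ideal.Quotient.mk (I ^ ℓ) p ↔ f - ψ p ∈ J ℓ := by
  let θ (ℓ : ℕ) : (R ⧸ I ^ ℓ) →ₐ[k] O ⧸ J ℓ := Ideal.quotientMapₐ (J ℓ) ψ (comap_eq ℓ).ge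
  have θ_mk (ℓ : ℕ) (p : R) : θ ℓ (Ideal.Quotient.mk _ p) = Ideal.Quotient.mk (J ℓ) (ψ p) := rfl
  have θ_bijective (ℓ : ℕ) : Function.Bijective (θ ℓ) := by
    refine ⟨Ideal.quotientMap_injective' (H := (comap_eq ℓ).ge) (comap_eq ℓ).le, fun x => ?_⟩
    obtain ⟨f, rfl⟩ := Ideal.Quotient.mk_surjective x
    obtain ⟨p, hp⟩ := dense ℓ f
    exact ⟨Ideal.Quotient.mk _ p, (Ideal.Quotient.eq.2 hp).symm⟩
  let φ : O →ₐ[k] (ℓ : ℕ) → R ⧸ I ^ ℓ := AlgHom.pi fun ℓ =>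
    (AlgEquiv.ofBijective (θ ℓ) (θ_bijective ℓ)).symm.toAlgHom.comp (Ideal.Quotient.mkₐ k (J ℓ))
  have φ_eq_mk (f : O) (ℓ : ℕ) (p : R) : φ f ℓ = Ideal.Quotient.mk _ p ↔ f - ψ p ∈ J ℓ := by
    rw [← Ideal.Quotient.eq, ← θ_mk]
    exact (AlgEquiv.ofBijective (θ ℓ) (θ_bijective ℓ)).symm_apply_eq
  have φ_mem (f : O) : φ f ∈ powerCompletion (k := k) I := fun m n hmn => by
    obtain ⟨p, hp⟩ := dense n f
    rw [(φ_eq_mk f n p).2 hp, Ideal.Quotient.factor_mk, eq_comm, φ_eq_mk]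
    exact antitone hmn hp
  refine ⟨AlgEquiv.ofBijective (φ.codRestrict _ φ_mem) ⟨?_, fun x => ?_⟩, φ_eq_mk⟩
  · refine (injective_iff_map_eq_zero _).2 fun f hf => ?_
    rw [← Submodule.mem_bot O, ← separated, Submodule.mem_iInf]
    intro ℓ
    have h := (φ_eq_mk f ℓ 0).1 (by rw [map_zero]; exact congrFun (congrArg Subtype.val hf) ℓ)
    rwa [map_zero, sub_zero] at h
  · choose p hp using fun ℓ => Ideal.Quotient.mk_surjective (x.1 ℓ)
    obtain ⟨f, hf⟩ := complete p fun m n hmn => by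
      rw [← Ideal.Quotient.eq, hp m, ← x.2 m n hmn, ← hp n, Ideal.Quotient.factor_mk]
    exact ⟨f, Subtype.ext <| funext fun ℓ => ((φ_eq_mk f ℓ _).2 (hf ℓ)).trans (hp ℓ)⟩

end

/-! ### Modules over the free algebra -/

section

variable {k X W : Type*} [CommRing k] [AddCommGroup W] [Module k W]

/-- The space `W` as a module over the free algebra, the generators acting by the
endomorphisms `a`. -/
def FreeAEval (_a : X → Module.End k W) : Type _ := W

namespace FreeAEval

variable (a : X → Module.End k W)

instance : AddCommGroup (FreeAEval a) := inferInstanceAs (AddCommGroup W)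

instance : Module k (FreeAEval a) := inferInstanceAs (Module k W)

noncomputable instance : Module (FreeAlgebra k X) (FreeAEval a) :=
  Module.compHom W (FreeAlgebra.lift k a).toRingHom

instance [Module.Finite k W] : Module.Finite k (FreeAEval a) := inferInstanceAs (Module.Finite k W)

variable {a}

theorem smul_eq_lift (p : FreeAlgebra k X) (w : FreeAEval a) :
    p • w = (FreeAlgebra.lift k a p w : W) := rfl

theorem ι_smul (j : X) (w : FreeAEval a) : FreeAlgebra.ι k j • w = (a j w : W) := by
  rw [smul_eq_lift, FreeAlgebra.lift_ι_apply]

instance : IsScalarTower k (FreeAlgebra k X) (FreeAEval a) where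
  smul_assoc c p w := by
    rw [smul_eq_lift, map_smul]
    rfl

/-- A linear map that carries the action of the generators to the endomorphisms `a`, as a
linear map over the free algebra. -/
def homOfGenerators {M : Type*} [AddCommGroup M] [Module k M] [Module (FreeAlgebra k X) M]
    [IsScalarTower k (FreeAlgebra k X) M] (φ : M →ₗ[k] W)
    (hφ : ∀ (j : X) (x), φ (FreeAlgebra.ι k j • x) = a j (φ x)) :
    M →ₗ[FreeAlgebra k X] FreeAEval a where
  toFun := φ
  map_add' := map_add φ
  map_smul' p x := by
    change φ (p • x) = FreeAlgebra.lift k a p (φ x)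
    induction p using FreeAlgebra.induction generalizing x with
    | grade0 c => rw [algebraMap_smul, map_smul, AlgHom.commutes, Module.algebraMap_end_apply]
    | grade1 j => rw [hφ, FreeAlgebra.lift_ι_apply]
    | mul p q hp hq => rw [mul_smul, hp, hq, map_mul, Module.End.mul_apply]
    | add p q hp hq => rw [add_smul, map_add, hp, hq, map_add, LinearMap.add_apply]

end FreeAEval

end

/-! ### Sequences of multilinear maps as linear maps on the tensor algebra -/

section

variable {k V A : Type*} [CommRing k] [AddCommGroup V] [Module k V] [Ring A] [Algebra k A]

theorem tensorAlgebra_word_induction {P : TensorAlgebra k V → Prop}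
    (word : ∀ L : List V, P (L.map (TensorAlgebra.ι k)).prod)
    (add : ∀ v w, P v → P w → P (v + w)) (smul : ∀ (c : k) (w), P w → P (c • w))
    (w : TensorAlgebra k V) : P w := by
  have hw : w ∈ Submodule.span k
      (Submonoid.closure (Set.range (TensorAlgebra.ι k (M := V))) : Set (TensorAlgebra k V)) := by
    rw [← Algebra.adjoin_eq_span, TensorAlgebra.adjoin_range_ι, Algebra.top_toSubmodule]
    exact Submodule.mem_top
  induction hw using Submodule.span_induction with
  | mem w hw =>
    obtain ⟨l, hl, rfl⟩ := Submonoid.exists_list_of_mem_closure hw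
    obtain ⟨L, rfl⟩ := (Set.range_list_map (TensorAlgebra.ι k)).ge hl
    exact word L
  | zero => simpa using smul 0 _ (word [])
  | add v w _ _ hv hw => exact add v w hv hw
  | smul c w _ hw => exact smul c w hw

namespace MultiSeq

theorem apply_ext {f h : MultiSeq k V A} {n : ℕ} (H : ∀ z, f.app n z = h.app n z) : f n = h n := by
  refine MultilinearMap.ext fun Z => ?_
  simpa [app] using H fun i => if hi : i < n then Z ⟨i, hi⟩ else 0

/-- The linear map on the tensor algebra of `V` that restricts to `f n` on the `n`-th tensor
power of `V`. -/
noncomputable def tensorLift (f : MultiSeq k V A) : TensorAlgebra k V →ₗ[k] A :=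
  DirectSum.toModule k ℕ A (fun n => PiTensorProduct.lift (f n)) ∘ₗ
    TensorAlgebra.equivDirectSum.toLinearMap

theorem tensorLift_tprod (f : MultiSeq k V A) {n : ℕ} (Z : Fin n → V) :
    f.tensorLift (TensorAlgebra.tprod k V n Z) = f n Z := by
  change DirectSum.toModule k ℕ A _ (TensorAlgebra.toDirectSum _) = _
  rw [TensorAlgebra.toDirectSum_tensorPower_tprod, ← DirectSum.lof_eq_of k,
    DirectSum.toModule_lof, PiTensorProduct.lift.tprod]

theorem tensorLift_prod_ι (f : MultiSeq k V A) (L : List V) (z : ℕ → V)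
    (hz : ∀ (i : ℕ) (hi : i < L.length), L[i] = z i) :
    f.tensorLift (L.map (TensorAlgebra.ι k)).prod = f.app L.length z := by
  have h : L.map (TensorAlgebra.ι k) =
      List.ofFn fun i : Fin L.length => TensorAlgebra.ι k (z i) :=
    List.ext_getElem (by simp) (by simp +contextual [hz])
  rw [h, ← TensorAlgebra.tprod_apply, tensorLift_tprod]
  rfl

theorem tensorLift_add (f h : MultiSeq k V A) (w : TensorAlgebra k V) :
    (f + h).tensorLift w = f.tensorLift w + h.tensorLift w := by
  induction w using tensorAlgebra_word_induction with
  | word L =>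
    simp only [tensorLift_prod_ι _ L (L.getD · 0) (by grind), app_add]
  | add v w hv hw => simp only [map_add, hv, hw, add_add_add_comm]
  | smul c w hw => simp only [map_smul, hw, smul_add]

theorem tensorLift_smul (c : k) (f : MultiSeq k V A) (w : TensorAlgebra k V) :
    (c • f).tensorLift w = c • f.tensorLift w := by
  induction w using tensorAlgebra_word_induction with
  | word L =>
    simp only [tensorLift_prod_ι _ L (L.getD · 0) (by grind), app_smul]
  | add v w hv hw => simp only [map_add, hv, hw, smul_add]
  | smul c' w hw => simp only [map_smul, hw, smul_comm c]

theorem tensorLift_one_one : (1 : MultiSeq k V A).tensorLift 1 = 1 := by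
  simpa [app_one] using (1 : MultiSeq k V A).tensorLift_prod_ι [] 0 (by simp)

theorem tensorLift_one_mul_ι (w : TensorAlgebra k V) (v : V) :
    (1 : MultiSeq k V A).tensorLift (w * TensorAlgebra.ι k v) = 0 := by
  induction w using tensorAlgebra_word_induction with
  | word L =>
    have h := (1 : MultiSeq k V A).tensorLift_prod_ι (L ++ [v]) ((L ++ [v]).getD · 0) (by grind)
    simpa [app_one] using h
  | add u w hu hw => rw [add_mul, map_add, hu, hw, add_zero]
  | smul c w hw => rw [smul_mul_assoc, map_smul, hw, smul_zero]

variable {m n : Type*}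

/-- The entrywise extension of `tensorLift` to matrices over the tensor algebra. -/
noncomputable def matrixLift (f : MultiSeq k V A) :
    Matrix m n (TensorAlgebra k V) →ₗ[k] Matrix m n A :=
  f.tensorLift.mapMatrix

theorem matrixLift_apply (f : MultiSeq k V A) (W : Matrix m n (TensorAlgebra k V)) (a : m)
    (b : n) : f.matrixLift W a b = f.tensorLift (W a b) := rfl

theorem matrixLift_one [DecidableEq n] (f : MultiSeq k V A) :
    f.matrixLift (1 : Matrix n n (TensorAlgebra k V)) = diagonal fun _ => f.tensorLift 1 :=
  diagonal_map (map_zero _)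

theorem mul_apply_eq_zero {f h : MultiSeq k V A} {a b m : ℕ} (hf : ∀ i < a, f i = 0)
    (hh : ∀ i < b, h i = 0) (hm : m < a + b) : (f * h) m = 0 := by
  refine apply_ext (h := (0 : MultiSeq k V A)) fun z => ?_
  rw [app_mul, app_zero]
  refine sum_eq_zero fun i hi => ?_
  have := mem_range.1 hi
  rcases lt_or_ge i a with hia | hia
  · rw [app, hf i hia, _root_.zero_apply, zero_mul]
  · rw [app, app, hh (m - i) (by omega), _root_.zero_apply, mul_zero]

variable (k V A) in
/-- The sequences of multilinear maps whose terms of degree less than `ℓ` vanish. -/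
def orderIdeal (ℓ : ℕ) : Ideal (MultiSeq k V A) where
  carrier := {f | ∀ m < ℓ, f m = 0}
  zero_mem' _ _ := rfl
  add_mem' {f h} hf hh m hm := by
    change f m + h m = 0
    rw [hf m hm, hh m hm, add_zero]
  smul_mem' f h hh _ hm := mul_apply_eq_zero (a := 0) (f := f) (by simp) hh (by simpa using hm)

instance (ℓ : ℕ) : (orderIdeal k V A ℓ).IsTwoSided where
  mul_mem_of_left h hf _ hm := mul_apply_eq_zero (b := 0) (h := h) hf (by simp) hm

theorem mul_mem_orderIdeal {f h : MultiSeq k V A} {a b : ℕ} (hf : f ∈ orderIdeal k V A a)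
    (hh : h ∈ orderIdeal k V A b) : f * h ∈ orderIdeal k V A (a + b) :=
  fun _ => mul_apply_eq_zero hf hh

theorem tensorLift_eq_zero {f : MultiSeq k V A} {i : ℕ} (hf : f i = 0) {t : TensorAlgebra k V}
    (ht : t ∈ LinearMap.range (TensorAlgebra.ι k (M := V)) ^ i) : f.tensorLift t = 0 := by
  rw [← Submodule.span_eq (LinearMap.range _), Submodule.span_pow] at ht
  induction ht using Submodule.span_induction with
  | mem t ht =>
    obtain ⟨c, rfl⟩ := Set.mem_pow.1 ht
    choose v hv using fun r => (c r).2
    simp only [← hv, ← TensorAlgebra.tprod_apply, tensorLift_tprod, hf,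
      _root_.zero_apply]
  | zero => exact map_zero _
  | add t u _ _ ht hu => rw [map_add, ht, hu, add_zero]
  | smul c t _ ht => rw [map_smul, ht, smul_zero]

end MultiSeq

end

/-! ### The relations of a germ for products of tensors -/

section

variable {k : Type*} [Field k] {g s : ℕ} {Y : Point k g s}
  {f : MultiSeq k (Point k g s) (Matrix (Fin s) (Fin s) k)}

open TensorAlgebra (ι)

theorem LAC.tensorLift_comm (hf : LAC Y f) (S : Matrix (Fin s) (Fin s) k) :
    f.tensorLift (ι k (comm S Y)) = S * f.tensorLift 1 - f.tensorLift 1 * S := by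
  have h := (lac_iff_app Y f).1 hf 0 0 le_rfl S 0
  have h1 := f.tensorLift_prod_ι [comm S Y] (ins 0 (comm S Y) 0) (by grind [ins])
  have h0 := f.tensorLift_prod_ι [] 0 (by grind)
  simp_all

theorem LAC.tensorLift_comm_first (hf : LAC Y f) (S : Matrix (Fin s) (Fin s) k)
    (z : Point k g s) (L : List (Point k g s)) :
    f.tensorLift ((comm S Y :: z :: L).map (ι k)).prod =
      S * f.tensorLift ((z :: L).map (ι k)).prod -
        f.tensorLift ((lmul S z :: L).map (ι k)).prod := by
  set y : ℕ → Point k g s := ((z :: L).getD · 0)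
  rw [f.tensorLift_prod_ι _ (ins 0 (comm S Y) y) (by grind [ins]),
    f.tensorLift_prod_ι _ y (by grind),
    f.tensorLift_prod_ι _ (Function.update y 0 (lmul S (y 0))) (by grind)]
  simpa using (lac_iff_app Y f).1 hf (z :: L).length 0 (by simp) S y

theorem LAC.tensorLift_comm_last (hf : LAC Y f) (S : Matrix (Fin s) (Fin s) k)
    (L : List (Point k g s)) (z : Point k g s) :
    f.tensorLift ((L ++ [z, comm S Y]).map (ι k)).prod =
      f.tensorLift ((L ++ [rmul z S]).map (ι k)).prod -
        f.tensorLift ((L ++ [z]).map (ι k)).prod * S := by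
  set y : ℕ → Point k g s := ((L ++ [z]).getD · 0)
  rw [f.tensorLift_prod_ι _ (ins (L.length + 1) (comm S Y) y) (by grind [ins]),
    f.tensorLift_prod_ι _ (Function.update y L.length (rmul (y L.length) S)) (by grind),
    f.tensorLift_prod_ι _ y (by grind)]
  simpa using (lac_iff_app Y f).1 hf (L ++ [z]).length (L.length + 1) (by simp) S y

theorem LAC.tensorLift_comm_middle (hf : LAC Y f) (S : Matrix (Fin s) (Fin s) k)
    (L : List (Point k g s)) (z z' : Point k g s) (L' : List (Point k g s)) :
    f.tensorLift ((L ++ z :: comm S Y :: z' :: L').map (ι k)).prod =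
      f.tensorLift ((L ++ rmul z S :: z' :: L').map (ι k)).prod -
        f.tensorLift ((L ++ z :: lmul S z' :: L').map (ι k)).prod := by
  set y : ℕ → Point k g s := ((L ++ z :: z' :: L').getD · 0)
  rw [f.tensorLift_prod_ι _ (ins (L.length + 1) (comm S Y) y) (by grind [ins]),
    f.tensorLift_prod_ι _ (Function.update y L.length (rmul (y L.length) S)) (by grind),
    f.tensorLift_prod_ι _ (Function.update y (L.length + 1) (lmul S (y (L.length + 1))))
      (by grind)]
  simpa [add_assoc] using
    (lac_iff_app Y f).1 hf (L ++ z :: z' :: L').length (L.length + 1) (by simp) S y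

theorem LAC.tensorLift_ι_comm_ι_mul (hf : LAC Y f) (S : Matrix (Fin s) (Fin s) k)
    (z : Point k g s) (w : TensorAlgebra k (Point k g s)) :
    f.tensorLift (ι k (comm S Y) * (ι k z * w)) =
      S * f.tensorLift (ι k z * w) - f.tensorLift (ι k (lmul S z) * w) := by
  induction w using tensorAlgebra_word_induction with
  | word L => simpa using hf.tensorLift_comm_first S z L
  | add v w hv hw => simp only [mul_add, map_add, hv, hw, add_sub_add_comm]
  | smul c w hw => simp only [mul_smul_comm, map_smul, hw, smul_sub]

theorem LAC.tensorLift_mul_ι_ι_comm (hf : LAC Y f) (S : Matrix (Fin s) (Fin s) k)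
    (w : TensorAlgebra k (Point k g s)) (z : Point k g s) :
    f.tensorLift (w * ι k z * ι k (comm S Y)) =
      f.tensorLift (w * ι k (rmul z S)) - f.tensorLift (w * ι k z) * S := by
  induction w using tensorAlgebra_word_induction with
  | word L => simpa [mul_assoc] using hf.tensorLift_comm_last S L z
  | add v w hv hw => simp only [add_mul, map_add, hv, hw, add_sub_add_comm]
  | smul c w hw => simp only [smul_mul_assoc, map_smul, hw, smul_sub]

theorem LAC.tensorLift_mul_ι_ι_comm_ι_mul (hf : LAC Y f) (S : Matrix (Fin s) (Fin s) k)
    (w : TensorAlgebra k (Point k g s)) (z z' : Point k g s) (w' : TensorAlgebra k (Point k g s)) :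
    f.tensorLift (w * ι k z * ι k (comm S Y) * (ι k z' * w')) =
      f.tensorLift (w * ι k (rmul z S) * (ι k z' * w')) -
        f.tensorLift (w * ι k z * (ι k (lmul S z') * w')) := by
  induction w using tensorAlgebra_word_induction with
  | word L =>
    induction w' using tensorAlgebra_word_induction with
    | word L' => simpa [mul_assoc] using hf.tensorLift_comm_middle S L z z' L'
    | add v w hv hw => simp only [mul_add, map_add, hv, hw, add_sub_add_comm]
    | smul c w hw => simp only [mul_smul_comm, map_smul, hw, smul_sub]
  | add v w hv hw => simp only [add_mul, map_add, hv, hw, add_sub_add_comm]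
  | smul c w hw => simp only [smul_mul_assoc, map_smul, hw, smul_sub]

end

/-! ### Tuples of block matrices -/

section

variable {k : Type*} [Field k] {g s : ℕ} {l m n p : Type*}

open TensorAlgebra (ι)

variable (k g s) in
/-- `g`-tuples of block matrices with `s × s` blocks. -/
abbrev BlockTuple (m n : Type*) : Type _ := Fin g → Matrix m n (Matrix (Fin s) (Fin s) k)

/-- The matrix over the tensor algebra of `Point k g s` whose entries are the entries of a tuple
of block matrices. -/
noncomputable def tensorMatrix (T : BlockTuple k g s m n) :
    Matrix m n (TensorAlgebra k (Point k g s)) :=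
  of fun a b => ι k fun j => T j a b

theorem tensorMatrix_apply (T : BlockTuple k g s m n) (a : m) (b : n) :
    tensorMatrix T a b = ι k fun j => T j a b := rfl

theorem tensorMatrix_sub (T T' : BlockTuple k g s m n) :
    tensorMatrix (T - T') = tensorMatrix T - tensorMatrix T' :=
  Matrix.ext fun a b => map_sub (ι k) (fun j => T j a b) (fun j => T' j a b)

theorem tensorMatrix_mul_left_apply [Fintype m] (R : Matrix l m (Matrix (Fin s) (Fin s) k))
    (T : BlockTuple k g s m n) (a : l) (b : n) :
    tensorMatrix (fun j => R * T j) a b = ∑ c, ι k (lmul (R a c) fun j => T j c b) := by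
  rw [tensorMatrix_apply, ← map_sum]
  congr 1
  funext j
  simp [mul_apply, lmul, Finset.sum_apply]

theorem tensorMatrix_mul_right_apply [Fintype m] (T : BlockTuple k g s l m)
    (R : Matrix m n (Matrix (Fin s) (Fin s) k)) (a : l) (b : n) :
    tensorMatrix (fun j => T j * R) a b = ∑ c, ι k (rmul (fun j => T j a c) (R c b)) := by
  rw [tensorMatrix_apply, ← map_sum]
  congr 1
  funext j
  simp [mul_apply, rmul, Finset.sum_apply]

variable (n) in
/-- The direct sum of copies of `Y` indexed by `n`. -/
def diagonalTuple [DecidableEq n] (Y : Point k g s) : BlockTuple k g s n n :=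
  fun j => diagonal fun _ => Y j

/-- The commutators `R (Y_j ⊕ ⋯ ⊕ Y_j) - (Y_j ⊕ ⋯ ⊕ Y_j) R`. -/
def blockComm [Fintype m] [DecidableEq m] [Fintype n] [DecidableEq n]
    (R : Matrix m n (Matrix (Fin s) (Fin s) k)) (Y : Point k g s) : BlockTuple k g s m n :=
  fun j => R * diagonalTuple n Y j - diagonalTuple m Y j * R

theorem tensorMatrix_blockComm_apply [Fintype m] [DecidableEq m] [Fintype n] [DecidableEq n]
    (R : Matrix m n (Matrix (Fin s) (Fin s) k)) (Y : Point k g s) (a : m) (b : n) :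
    tensorMatrix (blockComm R Y) a b = ι k (comm (R a b) Y) := by
  rw [tensorMatrix_apply]
  congr 1
  funext j
  simp only [blockComm, diagonalTuple, comm, Matrix.sub_apply, mul_diagonal, diagonal_mul]

/-- The direct sum `Y ⊕ ⋯ ⊕ Y` perturbed by the tuple `T` of block matrices. -/
def blockPoint [DecidableEq n] (Y : Point k g s) (T : BlockTuple k g s n n) :
    BlockTuple k g s n n :=
  diagonalTuple n Y + T

variable {Y : Point k g s}

theorem blockPoint_zero [DecidableEq n] :
    blockPoint Y (0 : BlockTuple k g s n n) = diagonalTuple n Y :=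
  add_zero _

theorem blockPoint_fromBlocks [DecidableEq m] [DecidableEq n] (T : BlockTuple k g s m m)
    (B : BlockTuple k g s m n) (T' : BlockTuple k g s n n) (j : Fin g) :
    blockPoint Y (fun j => fromBlocks (T j) (B j) 0 (T' j)) j =
      fromBlocks (blockPoint Y T j) (B j) 0 (blockPoint Y T' j) := by
  ext1 (a | a) (b | b) <;> simp [blockPoint, diagonalTuple, diagonal_apply]

theorem blockComm_of_intertwining [Fintype m] [DecidableEq m] [Fintype n] [DecidableEq n]
    {T : BlockTuple k g s n n} {T' : BlockTuple k g s m m}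
    {R : Matrix m n (Matrix (Fin s) (Fin s) k)}
    (hR : ∀ j, R * blockPoint Y T j = blockPoint Y T' j * R) :
    blockComm R Y = (fun j => T' j * R : BlockTuple k g s m n) - fun j => R * T j := by
  funext j
  have h := hR j
  simp only [blockPoint, Pi.add_apply, Matrix.mul_add, Matrix.add_mul] at h
  exact sub_eq_sub_iff_add_eq_add.2 (by rw [h, add_comm])

variable {f : MultiSeq k (Point k g s) (Matrix (Fin s) (Fin s) k)}

theorem LAC.matrixLift_blockComm [Fintype m] [DecidableEq m] [Fintype n] [DecidableEq n]
    (hf : LAC Y f) (R : Matrix m n (Matrix (Fin s) (Fin s) k)) :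
    f.matrixLift (tensorMatrix (blockComm R Y)) =
      R * f.matrixLift (1 : Matrix n n _) - f.matrixLift (1 : Matrix m m _) * R := by
  ext1 a b
  simp only [f.matrixLift_one, Matrix.sub_apply, mul_diagonal, diagonal_mul, f.matrixLift_apply,
    tensorMatrix_blockComm_apply, hf.tensorLift_comm]

theorem LAC.matrixLift_blockComm_mul [Fintype l] [DecidableEq l] [Fintype m] [DecidableEq m]
    [Fintype n] (hf : LAC Y f)
    (R : Matrix l m (Matrix (Fin s) (Fin s) k)) (T : BlockTuple k g s m n)
    (Q : Matrix n p (TensorAlgebra k (Point k g s))) :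
    f.matrixLift (tensorMatrix (blockComm R Y) * (tensorMatrix T * Q)) =
      R * f.matrixLift (tensorMatrix T * Q) -
        f.matrixLift (tensorMatrix (fun j => R * T j) * Q) := by
  ext1 a b
  simp only [MultiSeq.matrixLift_apply, Matrix.sub_apply, mul_apply,
    tensorMatrix_mul_left_apply,
    tensorMatrix_blockComm_apply, Finset.mul_sum, Finset.sum_mul, map_sum]
  rw [sum_comm (s := univ (α := n)), ← sum_sub_distrib]
  refine sum_congr rfl fun c _ => ?_
  rw [← sum_sub_distrib]
  exact sum_congr rfl fun d _ => hf.tensorLift_ι_comm_ι_mul _ _ _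

theorem LAC.matrixLift_mul_blockComm [Fintype l] [Fintype m] [DecidableEq m] [Fintype n]
    [DecidableEq n] (hf : LAC Y f)
    (P : Matrix p l (TensorAlgebra k (Point k g s))) (T : BlockTuple k g s l m)
    (R : Matrix m n (Matrix (Fin s) (Fin s) k)) :
    f.matrixLift (P * tensorMatrix T * tensorMatrix (blockComm R Y)) =
      f.matrixLift (P * tensorMatrix (fun j => T j * R)) -
        f.matrixLift (P * tensorMatrix T) * R := by
  ext1 a b
  simp only [MultiSeq.matrixLift_apply, Matrix.sub_apply, mul_apply,
    tensorMatrix_mul_right_apply,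
    tensorMatrix_blockComm_apply, Finset.mul_sum, Finset.sum_mul, map_sum]
  rw [sum_comm (s := univ (α := l)), ← sum_sub_distrib]
  refine sum_congr rfl fun c _ => ?_
  rw [← sum_sub_distrib]
  exact sum_congr rfl fun d _ => hf.tensorLift_mul_ι_ι_comm _ _ _

theorem LAC.matrixLift_mul_blockComm_mul {q r : Type*} [Fintype l] [Fintype m] [DecidableEq m]
    [Fintype n] [DecidableEq n] [Fintype p] (hf : LAC Y f)
    (P : Matrix q l (TensorAlgebra k (Point k g s))) (T : BlockTuple k g s l m)
    (R : Matrix m n (Matrix (Fin s) (Fin s) k)) (T' : BlockTuple k g s n p)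
    (Q : Matrix p r (TensorAlgebra k (Point k g s))) :
    f.matrixLift (P * tensorMatrix T * tensorMatrix (blockComm R Y) * (tensorMatrix T' * Q)) =
      f.matrixLift (P * tensorMatrix (fun j => T j * R) * (tensorMatrix T' * Q)) -
        f.matrixLift (P * tensorMatrix T * (tensorMatrix (fun j => R * T' j) * Q)) := by
  ext1 a b
  simp only [MultiSeq.matrixLift_apply, Matrix.sub_apply, mul_apply,
    tensorMatrix_mul_right_apply, tensorMatrix_mul_left_apply,
    tensorMatrix_blockComm_apply, Finset.mul_sum, Finset.sum_mul, map_sum]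
  rw [sum_comm_cycle (s := univ (α := m)), ← sum_sub_distrib]
  refine sum_congr rfl fun c _ => ?_
  rw [sum_comm (s := univ (α := m)), ← sum_sub_distrib]
  refine sum_congr rfl fun d _ => ?_
  rw [sum_comm (s := univ (α := l)), ← sum_sub_distrib]
  refine sum_congr rfl fun e _ => ?_
  rw [← sum_sub_distrib]
  exact sum_congr rfl fun h _ => hf.tensorLift_mul_ι_ι_comm_ι_mul _ _ _ _ _

end

/-! ### Evaluation at nilpotent perturbations -/

section

variable {k : Type*} [Field k] {g s : ℕ} {Y : Point k g s}
  {f : MultiSeq k (Point k g s) (Matrix (Fin s) (Fin s) k)}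
  {m n : Type*} [Fintype n] [DecidableEq n]

/-- The value `∑_{n < ℓ} f_n(T, …, T)` of a sequence of multilinear maps at a tuple `T` of block
matrices, meant for `T` whose `ℓ`-th tensor power vanishes. -/
noncomputable def MultiSeq.nilEval (f : MultiSeq k (Point k g s) (Matrix (Fin s) (Fin s) k))
    (ℓ : ℕ) (T : BlockTuple k g s n n) :
    Matrix n n (Matrix (Fin s) (Fin s) k) :=
  ∑ i ∈ range ℓ, f.matrixLift (tensorMatrix T ^ i)

theorem LAC.mul_nilEval [Fintype m] [DecidableEq m]
    (hf : LAC Y f) {ℓ : ℕ} {T : BlockTuple k g s n n} {T' : BlockTuple k g s m m}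
    {R : Matrix m n (Matrix (Fin s) (Fin s) k)}
    (hT : tensorMatrix T ^ ℓ = 0) (hT' : tensorMatrix T' ^ ℓ = 0)
    (hR : ∀ j, R * blockPoint Y T j = blockPoint Y T' j * R) :
    R * f.nilEval ℓ T = f.nilEval ℓ T' * R := by
  set t := tensorMatrix T
  set t' := tensorMatrix T'
  set u := tensorMatrix fun j => T' j * R
  set v := tensorMatrix fun j => R * T j
  have huv : tensorMatrix (blockComm R Y) = u - v := by
    rw [blockComm_of_intertwining hR, tensorMatrix_sub]
  -- The value of `f` on `t' ^ i * R * t ^ j`, where `α` lets the tensor factor to the left of `R`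
  -- absorb `R` and `β` the one to the right; without such a factor, `R` multiplies the value.
  let α : ℕ → ℕ → Matrix m n (Matrix (Fin s) (Fin s) k)
    | 0, j => R * f.matrixLift (t ^ j)
    | i + 1, j => f.matrixLift (t' ^ i * u * t ^ j)
  let β : ℕ → ℕ → Matrix m n (Matrix (Fin s) (Fin s) k)
    | i, 0 => f.matrixLift (t' ^ i) * R
    | i, j + 1 => f.matrixLift (t' ^ i * v * t ^ j)
  have square (i j : ℕ) : α (i + 1) j - α i j = β i (j + 1) - β i j := by
    rw [sub_eq_sub_iff_sub_eq_sub]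
    rcases i with - | i <;> rcases j with - | j <;>
      simp only [α, β, pow_zero, Matrix.one_mul, Matrix.mul_one, zero_add] <;>
      rw [← map_sub]
    · rw [← huv, hf.matrixLift_blockComm]
    · rw [← Matrix.sub_mul, ← huv, pow_succ', hf.matrixLift_blockComm_mul]
    · rw [← Matrix.mul_sub, ← huv, pow_succ, hf.matrixLift_mul_blockComm]
    · rw [← Matrix.sub_mul, ← Matrix.mul_sub, ← huv, pow_succ t' i, pow_succ' t j,
        hf.matrixLift_mul_blockComm_mul, ← pow_succ,
        Matrix.mul_assoc _ _ (t ^ j), Matrix.mul_assoc (t' ^ i)]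
  have h := sum_range_sub_eq_of_square α β square (ℓ + 1)
  rw [MultiSeq.nilEval, MultiSeq.nilEval]
  simpa only [α, β, hT, hT', Matrix.zero_mul, Matrix.mul_zero, map_zero, zero_sub, neg_zero,
    add_zero, sum_neg_distrib, neg_inj, sum_range_succ _ ℓ, ← Matrix.mul_sum, ← Matrix.sum_mul]
    using h

theorem MultiSeq.nilEval_add (f h : MultiSeq k (Point k g s) (Matrix (Fin s) (Fin s) k)) (ℓ : ℕ)
    (T : BlockTuple k g s n n) : (f + h).nilEval ℓ T = f.nilEval ℓ T + h.nilEval ℓ T := by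
  simp only [MultiSeq.nilEval, ← sum_add_distrib]
  exact sum_congr rfl fun i _ => Matrix.ext fun a b => MultiSeq.tensorLift_add _ _ _

theorem MultiSeq.nilEval_sub (f h : MultiSeq k (Point k g s) (Matrix (Fin s) (Fin s) k)) (ℓ : ℕ)
    (T : BlockTuple k g s n n) : (f - h).nilEval ℓ T = f.nilEval ℓ T - h.nilEval ℓ T :=
  eq_sub_of_add_eq (by rw [← MultiSeq.nilEval_add, sub_add_cancel])

theorem MultiSeq.nilEval_smul (c : k) (f : MultiSeq k (Point k g s) (Matrix (Fin s) (Fin s) k))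
    (ℓ : ℕ) (T : BlockTuple k g s n n) : (c • f).nilEval ℓ T = c • f.nilEval ℓ T := by
  simp only [MultiSeq.nilEval, Finset.smul_sum]
  exact sum_congr rfl fun i _ => Matrix.ext fun a b => MultiSeq.tensorLift_smul c f _

theorem MultiSeq.nilEval_one {ℓ : ℕ} {T : BlockTuple k g s n n} (hT : tensorMatrix T ^ ℓ = 0) :
    (1 : MultiSeq k (Point k g s) (Matrix (Fin s) (Fin s) k)).nilEval ℓ T = 1 := by
  cases ℓ with
  | zero =>
    ext a
    exact absurd (congrFun₂ hT a a) (by simp)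
  | succ ℓ =>
    rw [MultiSeq.nilEval, sum_range_succ', sum_eq_zero, zero_add, pow_zero,
      MultiSeq.matrixLift_one, MultiSeq.tensorLift_one_one]
    · rfl
    · intro i _
      ext1 a b
      rw [pow_succ, MultiSeq.matrixLift_apply, mul_apply, map_sum]
      exact sum_eq_zero fun c _ => MultiSeq.tensorLift_one_mul_ι _ _

theorem tensorMatrix_pow_apply_mem (T : BlockTuple k g s n n) (i : ℕ) (a b : n) :
    (tensorMatrix T ^ i) a b ∈ LinearMap.range (TensorAlgebra.ι k (M := Point k g s)) ^ i := by
  induction i generalizing b with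
  | zero =>
    rw [pow_zero, pow_zero, one_apply]
    split_ifs
    exacts [Submodule.one_le.1 le_rfl, Submodule.zero_mem _]
  | succ i ih =>
    rw [pow_succ, pow_succ, mul_apply]
    exact Submodule.sum_mem _ fun c _ => Submodule.mul_mem_mul (ih c) ⟨_, rfl⟩

theorem MultiSeq.nilEval_eq_zero {f : MultiSeq k (Point k g s) (Matrix (Fin s) (Fin s) k)} {ℓ : ℕ}
    (hf : f ∈ MultiSeq.orderIdeal k _ _ ℓ) (T : BlockTuple k g s n n) : f.nilEval ℓ T = 0 := by
  refine sum_eq_zero fun i hi => ?_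
  ext1 a b
  rw [MultiSeq.matrixLift_apply]
  exact MultiSeq.tensorLift_eq_zero (hf i (mem_range.1 hi)) (tensorMatrix_pow_apply_mem T i a b)

theorem tensorMatrix_fromBlocks_pow_succ_eq_zero [Fintype m] [DecidableEq m]
    {T : BlockTuple k g s m m} {ℓ : ℕ} (hT : tensorMatrix T ^ ℓ = 0) (B : BlockTuple k g s m n) :
    tensorMatrix (fun j => fromBlocks (T j) (B j) 0 0 : BlockTuple k g s (m ⊕ n) (m ⊕ n)) ^ (ℓ + 1)
      = 0 := by
  let t (i : ℕ) : Matrix (m ⊕ n) (m ⊕ n) (TensorAlgebra k (Point k g s)) :=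
    fromBlocks (tensorMatrix T ^ (i + 1)) (tensorMatrix T ^ i * tensorMatrix B) 0 0
  have tensorMatrix_eq :
      tensorMatrix (fun j => fromBlocks (T j) (B j) 0 0 : BlockTuple k g s (m ⊕ n) (m ⊕ n)) =
        t 0 := by
    simp only [t, zero_add, pow_one, pow_zero, Matrix.one_mul]
    ext (a | a) (b | b) <;> try rfl
    all_goals exact map_zero (TensorAlgebra.ι k)
  have pow_succ_eq (i : ℕ) : t 0 ^ (i + 1) = t i := by
    induction i with
    | zero => rw [zero_add, pow_one]
    | succ i ih =>
      rw [pow_succ', ih]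
      simp only [t, fromBlocks_multiply, zero_add, pow_zero, pow_one, Matrix.one_mul,
        Matrix.mul_zero, Matrix.zero_mul, add_zero, ← Matrix.mul_assoc, ← pow_succ']
  rw [tensorMatrix_eq, pow_succ_eq]
  simp only [t, pow_succ, hT, Matrix.zero_mul, fromBlocks_zero]

theorem tensorMatrix_fromBlocks_diagonal_pow [Fintype m] [DecidableEq m]
    (T : BlockTuple k g s m m) (T' : BlockTuple k g s n n) (i : ℕ) :
    tensorMatrix (fun j => fromBlocks (T j) 0 0 (T' j) : BlockTuple k g s (m ⊕ n) (m ⊕ n)) ^ i =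
      fromBlocks (tensorMatrix T ^ i) 0 0 (tensorMatrix T' ^ i) := by
  rw [← fromBlocks_diagonal_pow]
  congr 1
  ext (a | a) (b | b) <;> try rfl
  all_goals exact map_zero (TensorAlgebra.ι k)

theorem MultiSeq.nilEval_fromBlocks_diagonal [Fintype m] [DecidableEq m]
    (f : MultiSeq k (Point k g s) (Matrix (Fin s) (Fin s) k)) (ℓ : ℕ)
    (T : BlockTuple k g s m m) (T' : BlockTuple k g s n n) :
    f.nilEval ℓ (fun j => fromBlocks (T j) 0 0 (T' j) : BlockTuple k g s (m ⊕ n) (m ⊕ n)) =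
      fromBlocks (f.nilEval ℓ T) 0 0 (f.nilEval ℓ T') := by
  ext1 (a | a) (b | b) <;>
    simp [MultiSeq.nilEval, Matrix.sum_apply, MultiSeq.matrixLift_apply,
      tensorMatrix_fromBlocks_diagonal_pow]

end

/-! ### Germs of polynomials -/

section

variable {k : Type*} [Field k] {g s : ℕ} {Y : Point k g s}
  {f : MultiSeq k (Point k g s) (Matrix (Fin s) (Fin s) k)}
  {n : Type*} [Fintype n] [DecidableEq n]

open TensorAlgebra (ι)

/-- The germ of the `j`-th coordinate. -/
def coordSeq (Y : Point k g s) (j : Fin g) :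
    MultiSeq k (Point k g s) (Matrix (Fin s) (Fin s) k) := fun ℓ =>
  match ℓ with
  | 0 => MultilinearMap.constOfIsEmpty k _ (Y j)
  | 1 => (LinearMap.proj j : Point k g s →ₗ[k] Matrix (Fin s) (Fin s) k).compMultilinearMap
      (MultilinearMap.ofSubsingleton k _ _ (0 : Fin 1) LinearMap.id)
  | _ + 2 => 0

theorem app_coordSeq_zero (Y : Point k g s) (j : Fin g) (z : ℕ → Point k g s) :
    (coordSeq Y j).app 0 z = Y j := rfl

theorem app_coordSeq_one (Y : Point k g s) (j : Fin g) (z : ℕ → Point k g s) :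
    (coordSeq Y j).app 1 z = z 0 j := rfl

theorem app_coordSeq_add_two (Y : Point k g s) (j : Fin g) (n : ℕ) (z : ℕ → Point k g s) :
    (coordSeq Y j).app (n + 2) z = 0 := rfl

theorem lac_coordSeq (Y : Point k g s) (j : Fin g) : LAC Y (coordSeq Y j) := by
  rw [lac_iff_app]
  intro n p hp S z
  rcases n with _ | _ | n
  · obtain rfl : p = 0 := by omega
    simp [app_coordSeq_zero, app_coordSeq_one, comm, ins]
  · rw [app_coordSeq_add_two]
    have : p = 0 ∨ p = 1 := by omega
    rcases this with rfl | rfl <;> simp [app_coordSeq_one, lmul, rmul]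
  · rw [app_coordSeq_add_two]
    simp [app_coordSeq_add_two]

theorem app_mul_coordSeq_zero (f : MultiSeq k (Point k g s) (Matrix (Fin s) (Fin s) k))
    (Y : Point k g s) (j : Fin g) (z : ℕ → Point k g s) :
    (f * coordSeq Y j).app 0 z = f.app 0 z * Y j := by
  simp [MultiSeq.app_mul, app_coordSeq_zero]

theorem app_mul_coordSeq_succ (f : MultiSeq k (Point k g s) (Matrix (Fin s) (Fin s) k))
    (Y : Point k g s) (j : Fin g) (n : ℕ) (z : ℕ → Point k g s) :
    (f * coordSeq Y j).app (n + 1) z = f.app (n + 1) z * Y j + f.app n z * z n j := by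
  rw [MultiSeq.app_mul, sum_range_succ, sum_range_succ, sum_eq_zero, zero_add, add_comm]
  · simp [app_coordSeq_zero, app_coordSeq_one]
  · intro i hi
    obtain ⟨r, hr⟩ : ∃ r, n + 1 - i = r + 2 := ⟨n - 1 - i, by grind⟩
    rw [hr, app_coordSeq_add_two, mul_zero]

theorem tensorLift_mul_coordSeq_one (f : MultiSeq k (Point k g s) (Matrix (Fin s) (Fin s) k))
    (Y : Point k g s) (j : Fin g) :
    (f * coordSeq Y j).tensorLift 1 = f.tensorLift 1 * Y j := by
  have h (f : MultiSeq k (Point k g s) (Matrix (Fin s) (Fin s) k)) :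
      f.tensorLift 1 = f.app 0 0 := f.tensorLift_prod_ι [] 0 (by simp)
  rw [h, h, app_mul_coordSeq_zero]

theorem tensorLift_mul_coordSeq_mul_ι (f : MultiSeq k (Point k g s) (Matrix (Fin s) (Fin s) k))
    (Y : Point k g s) (j : Fin g) (w : TensorAlgebra k (Point k g s)) (v : Point k g s) :
    (f * coordSeq Y j).tensorLift (w * ι k v) =
      f.tensorLift (w * ι k v) * Y j + f.tensorLift w * v j := by
  induction w using tensorAlgebra_word_induction with
  | word L =>
    have hL : (L.map (ι k)).prod * ι k v = ((L ++ [v]).map (ι k)).prod := by simp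
    set z : ℕ → Point k g s := ((L ++ [v]).getD · 0)
    rw [hL, MultiSeq.tensorLift_prod_ι _ _ z (by grind),
      MultiSeq.tensorLift_prod_ι _ _ z (by grind), MultiSeq.tensorLift_prod_ι _ L z (by grind),
      List.length_append, List.length_singleton, app_mul_coordSeq_succ,
      show z L.length = v by grind]
  | add u w hu hw => simp only [add_mul, map_add, hu, hw]; abel
  | smul c w hw => simp only [smul_mul_assoc, map_smul, hw, smul_add]

theorem MultiSeq.nilEval_mul_coordSeq
    (f : MultiSeq k (Point k g s) (Matrix (Fin s) (Fin s) k)) (Y : Point k g s) (j : Fin g)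
    {ℓ : ℕ} {T : BlockTuple k g s n n} (hT : tensorMatrix T ^ ℓ = 0) :
    (f * coordSeq Y j).nilEval ℓ T = f.nilEval ℓ T * blockPoint Y T j := by
  have lift_one : (f * coordSeq Y j).matrixLift (1 : Matrix n n _) =
      f.matrixLift (1 : Matrix n n _) * diagonalTuple n Y j := by
    rw [MultiSeq.matrixLift_one, MultiSeq.matrixLift_one, diagonalTuple, diagonal_mul_diagonal,
      tensorLift_mul_coordSeq_one]
  have lift_mul (W : Matrix n n (TensorAlgebra k (Point k g s))) :
      (f * coordSeq Y j).matrixLift (W * tensorMatrix T) =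
        f.matrixLift (W * tensorMatrix T) * diagonalTuple n Y j + f.matrixLift W * T j := by
    ext1 a b
    simp only [diagonalTuple, Matrix.add_apply, mul_diagonal, MultiSeq.matrixLift_apply]
    simp only [mul_apply, map_sum, tensorMatrix_apply, tensorLift_mul_coordSeq_mul_ι,
      sum_add_distrib, sum_mul, MultiSeq.matrixLift_apply]
  have nilEval_eq (h : MultiSeq k (Point k g s) (Matrix (Fin s) (Fin s) k)) :
      h.nilEval ℓ T = h.matrixLift 1 + ∑ i ∈ range ℓ, h.matrixLift (tensorMatrix T ^ (i + 1)) := by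
    rw [← pow_zero (tensorMatrix T), add_comm,
      ← sum_range_succ' fun i => h.matrixLift (tensorMatrix T ^ i), sum_range_succ, hT, map_zero,
      add_zero]
    rfl
  rw [blockPoint, Pi.add_apply, Matrix.mul_add]
  conv_rhs => enter [1]; rw [nilEval_eq, Matrix.add_mul, Matrix.sum_mul]
  rw [nilEval_eq, MultiSeq.nilEval, lift_one, Matrix.sum_mul, add_assoc, ← sum_add_distrib]
  simp only [pow_succ, lift_mul]

/-- The homomorphism that sends a noncommutative polynomial to the sequence of its
differentials at `Y`. -/
noncomputable def taylor (Y : Point k g s) :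
    FreeAlgebra k (Fin g) →ₐ[k] MultiSeq k (Point k g s) (Matrix (Fin s) (Fin s) k) :=
  FreeAlgebra.lift k (coordSeq Y)

theorem lac_taylor (Y : Point k g s) (p : FreeAlgebra k (Fin g)) : LAC Y (taylor Y p) := by
  have h : (taylor Y).range ≤ formalGerms Y := by
    rw [taylor, ← Algebra.adjoin_range_eq_range_freeAlgebra_lift, Algebra.adjoin_le_iff]
    rintro _ ⟨j, rfl⟩
    exact lac_coordSeq Y j
  exact h ⟨p, rfl⟩

theorem MultiSeq.nilEval_mul_taylor (f : MultiSeq k (Point k g s) (Matrix (Fin s) (Fin s) k))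
    (Y : Point k g s) (p : FreeAlgebra k (Fin g)) {ℓ : ℕ} {T : BlockTuple k g s n n}
    (hT : tensorMatrix T ^ ℓ = 0) :
    (f * taylor Y p).nilEval ℓ T = f.nilEval ℓ T * FreeAlgebra.lift k (blockPoint Y T) p := by
  induction p using FreeAlgebra.induction generalizing f with
  | grade0 c =>
    simp only [AlgHom.commutes, ← Algebra.commutes c, ← Algebra.smul_def, MultiSeq.nilEval_smul]
  | grade1 j => simpa [taylor] using MultiSeq.nilEval_mul_coordSeq f Y j hT
  | mul p q hp hq => rw [map_mul, map_mul, ← mul_assoc, hq, hp, mul_assoc]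
  | add p q hp hq => rw [map_add, map_add, mul_add, mul_add, MultiSeq.nilEval_add, hp, hq]

theorem nilEval_taylor (Y : Point k g s) (p : FreeAlgebra k (Fin g)) {ℓ : ℕ}
    {T : BlockTuple k g s n n} (hT : tensorMatrix T ^ ℓ = 0) :
    (taylor Y p).nilEval ℓ T = FreeAlgebra.lift k (blockPoint Y T) p := by
  rw [← one_mul (taylor Y p), MultiSeq.nilEval_mul_taylor 1 Y p hT, MultiSeq.nilEval_one hT,
    one_mul]

theorem app_taylor_zero (Y : Point k g s) (p : FreeAlgebra k (Fin g)) (z : ℕ → Point k g s) :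
    (taylor Y p).app 0 z = FreeAlgebra.lift k Y p := by
  induction p using FreeAlgebra.induction with
  | grade0 c =>
    rw [AlgHom.commutes, AlgHom.commutes, Algebra.algebraMap_eq_smul_one, MultiSeq.app_smul,
      MultiSeq.app_one, if_pos rfl, Algebra.algebraMap_eq_smul_one]
  | grade1 j => rw [taylor, FreeAlgebra.lift_ι_apply, FreeAlgebra.lift_ι_apply, app_coordSeq_zero]
  | mul p q hp hq => simp [MultiSeq.app_mul, hp, hq]
  | add p q hp hq => rw [map_add, map_add, MultiSeq.app_add, hp, hq]

theorem taylor_mem_orderIdeal {ℓ : ℕ} {p : FreeAlgebra k (Fin g)} (hp : p ∈ vanishingIdeal Y ^ ℓ) :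
    taylor Y p ∈ MultiSeq.orderIdeal k (Point k g s) (Matrix (Fin s) (Fin s) k) ℓ := by
  induction ℓ generalizing p with
  | zero => exact fun m hm => absurd hm m.not_lt_zero
  | succ ℓ ih =>
    rw [Submodule.pow_succ] at hp
    induction hp using Submodule.mul_induction_on' with
    | mem_mul_mem p hp q hq =>
      rw [map_mul]
      refine MultiSeq.mul_mem_orderIdeal (ih hp) fun m hm => ?_
      obtain rfl : m = 0 := Nat.lt_one_iff.1 hm
      exact MultiSeq.apply_ext (h := 0) fun z => (app_taylor_zero Y q z).trans hq
    | add p _ q _ hp hq => exact map_add (taylor Y) p q ▸ add_mem hp hq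

theorem lift_blockPoint_eq_zero {ℓ : ℕ} {T : BlockTuple k g s n n} (hT : tensorMatrix T ^ ℓ = 0)
    {p : FreeAlgebra k (Fin g)} (hp : p ∈ vanishingIdeal Y ^ ℓ) :
    FreeAlgebra.lift k (blockPoint Y T) p = 0 := by
  rw [← nilEval_taylor Y p hT, MultiSeq.nilEval_eq_zero (taylor_mem_orderIdeal hp)]

/-- The tuple of `(ℓ + 1) × (ℓ + 1)` block matrices with superdiagonal `z 0, …, z (ℓ - 1)` and
zeros elsewhere. -/
def superdiagonal (ℓ : ℕ) (z : ℕ → Point k g s) : BlockTuple k g s (Fin (ℓ + 1)) (Fin (ℓ + 1)) :=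
  fun j => of fun a b => if a.1 + 1 = b.1 then z a j else 0

theorem blockPoint_superdiagonal (Y : Point k g s) (ℓ : ℕ) (z : ℕ → Point k g s) :
    blockPoint Y (superdiagonal ℓ z) = blockBidiag Y fun i : Fin ℓ => z i := by
  funext j
  ext1 a b
  by_cases h : a = b <;>
    simp [blockPoint, diagonalTuple, superdiagonal, blockBidiag, h]

theorem tensorMatrix_superdiagonal_pow (ℓ : ℕ) (z : ℕ → Point k g s) (i : ℕ) (a b : Fin (ℓ + 1)) :
    (tensorMatrix (superdiagonal ℓ z) ^ i) a b =
      if a.1 + i = b.1 then (((List.range i).map fun r => z (a + r)).map (ι k)).prod else 0 := by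
  induction i generalizing b with
  | zero => simp [one_apply, Fin.ext_iff]
  | succ i ih =>
    have entry (c : Fin (ℓ + 1)) : tensorMatrix (superdiagonal ℓ z) c b =
        if c.1 + 1 = b.1 then ι k (z c) else 0 := by
      rw [tensorMatrix_apply]
      simp only [superdiagonal, of_apply]
      split_ifs
      · rfl
      · exact map_zero _
    simp only [pow_succ, mul_apply, ih, entry]
    split_ifs with h
    · rw [sum_eq_single (⟨a + i, by omega⟩ : Fin (ℓ + 1))]
      · simp [List.range_succ, ← h, add_assoc]
      · grind
      · simp
    · grind [sum_eq_zero]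

theorem tensorMatrix_superdiagonal_pow_eq_zero (ℓ : ℕ) (z : ℕ → Point k g s) :
    tensorMatrix (superdiagonal ℓ z) ^ (ℓ + 1) = 0 := by
  ext a b
  rw [tensorMatrix_superdiagonal_pow, if_neg (by omega)]
  rfl

theorem MultiSeq.nilEval_superdiagonal_apply
    (f : MultiSeq k (Point k g s) (Matrix (Fin s) (Fin s) k)) (ℓ : ℕ) (z : ℕ → Point k g s)
    (a b : Fin (ℓ + 1)) :
    f.nilEval (ℓ + 1) (superdiagonal ℓ z) a b =
      if a ≤ b then f.app (b - a) fun i => z (a + i) else 0 := by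
  rw [MultiSeq.nilEval, Matrix.sum_apply]
  simp only [MultiSeq.matrixLift_apply, tensorMatrix_superdiagonal_pow, apply_ite f.tensorLift,
    map_zero]
  split_ifs with h
  · rw [sum_eq_single (b - a : ℕ)]
    · rw [if_pos (by omega), MultiSeq.tensorLift_prod_ι _ _ fun i => z (a + i)] <;> simp
    · grind
    · grind
  · exact sum_eq_zero fun i _ => if_neg (by omega)

theorem MultiSeq.mem_orderIdeal_of_nilEval_superdiagonal_eq_zero {ℓ : ℕ}
    (hf : ∀ z, f.nilEval (ℓ + 1) (superdiagonal ℓ z) = 0) :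
    f ∈ MultiSeq.orderIdeal k _ _ (ℓ + 1) := by
  intro i hi
  refine MultiSeq.apply_ext (h := (0 : MultiSeq k _ _)) fun z => ?_
  have h := congrFun₂ (hf z) 0 ⟨i, hi⟩
  rw [MultiSeq.nilEval_superdiagonal_apply, if_pos (Fin.zero_le _)] at h
  simpa [MultiSeq.app_zero] using h

theorem blockEval_eq_nilEval_taylor (Y : Point k g s) (p : FreeAlgebra k (Fin g)) (ℓ : ℕ)
    (z : ℕ → Point k g s) :
    blockEval Y (fun i : Fin ℓ => z i) p = (taylor Y p).nilEval (ℓ + 1) (superdiagonal ℓ z) := by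
  rw [nilEval_taylor Y p (tensorMatrix_superdiagonal_pow_eq_zero ℓ z), blockPoint_superdiagonal]
  rfl

theorem ncDiff_eq_app_taylor (Y : Point k g s) (p : FreeAlgebra k (Fin g)) (ℓ : ℕ)
    (z : ℕ → Point k g s) :
    ncDiff Y p ℓ (fun i => z i) = (taylor Y p).app ℓ z := by
  rw [ncDiff, blockEval_eq_nilEval_taylor, MultiSeq.nilEval_superdiagonal_apply,
    if_pos (Fin.zero_le _)]
  simp

theorem exists_nat_extension {ℓ : ℕ} {V : Type*} [Zero V] (Z : Fin ℓ → V) :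
    ∃ z : ℕ → V, (fun i : Fin ℓ => z i) = Z :=
  ⟨fun i => if hi : i < ℓ then Z ⟨i, hi⟩ else 0, by simp⟩

theorem mem_higherVanishingIdeal_iff {ℓ : ℕ} {p : FreeAlgebra k (Fin g)} :
    p ∈ higherVanishingIdeal Y ℓ ↔ taylor Y p ∈ MultiSeq.orderIdeal k _ _ (ℓ + 1) := by
  simp only [higherVanishingIdeal, Submodule.mem_iInf, RingHom.mem_ker]
  refine ⟨fun hp => MultiSeq.mem_orderIdeal_of_nilEval_superdiagonal_eq_zero fun z => ?_,
    fun hp Z => ?_⟩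
  · rw [← blockEval_eq_nilEval_taylor]
    exact hp _
  · obtain ⟨z, rfl⟩ := exists_nat_extension Z
    exact (blockEval_eq_nilEval_taylor Y p ℓ z).trans (MultiSeq.nilEval_eq_zero hp _)

theorem sub_taylor_mem_orderIdeal_iff {ℓ : ℕ} {p : FreeAlgebra k (Fin g)} :
    f - taylor Y p ∈ MultiSeq.orderIdeal k _ _ ℓ ↔
      ∀ m < ℓ, ∀ Z : Fin m → Point k g s, f m Z = ncDiff Y p m Z := by
  refine forall₂_congr fun m _ => sub_eq_zero.trans ⟨fun h Z => ?_, fun h => ?_⟩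
  · obtain ⟨z, rfl⟩ := exists_nat_extension Z
    rw [ncDiff_eq_app_taylor, h]
    rfl
  · exact MultiSeq.apply_ext fun z => (h _).trans (ncDiff_eq_app_taylor Y p m z)

end

/-! ### Modules annihilated by a power of the vanishing ideal -/

section

variable {k : Type*} [Field k] {g s : ℕ} {l m n : Type*} [Fintype n]

/-- The action of matrices with `s × s` blocks on tuples of vectors of length `s`. -/
noncomputable def blockMulVec :
    Matrix m n (Matrix (Fin s) (Fin s) k) →ₗ[k] (n → Fin s → k) →ₗ[k] m → Fin s → k :=
  LinearMap.mk₂ k (fun R x a => ∑ b, R a b *ᵥ x b)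
    (fun R S x => by ext1 a; simp [Matrix.add_mulVec, sum_add_distrib])
    (fun c R x => by ext1 a; simp [Matrix.smul_mulVec, Finset.smul_sum])
    (fun R x y => by ext1 a; simp [Matrix.mulVec_add, sum_add_distrib])
    (fun c R x => by ext1 a; simp [Matrix.mulVec_smul, Finset.smul_sum])

theorem blockMulVec_apply (R : Matrix m n (Matrix (Fin s) (Fin s) k)) (x : n → Fin s → k) (a : m) :
    blockMulVec R x a = ∑ b, R a b *ᵥ x b := rfl

theorem blockMulVec_mul [Fintype m] (R : Matrix l m (Matrix (Fin s) (Fin s) k))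
    (S : Matrix m n (Matrix (Fin s) (Fin s) k)) :
    blockMulVec (R * S) = blockMulVec R ∘ₗ blockMulVec S := by
  ext1 x
  funext a
  simp only [LinearMap.comp_apply, blockMulVec_apply, mul_apply, Matrix.sum_mulVec,
    Matrix.mulVec_sum, mulVec_mulVec]
  exact sum_comm

theorem blockMulVec_diagonal [DecidableEq n] (d : n → Matrix (Fin s) (Fin s) k)
    (x : n → Fin s → k) (a : n) : blockMulVec (diagonal d) x a = d a *ᵥ x a := by
  rw [blockMulVec_apply, sum_eq_single a]
  · rw [diagonal_apply_eq]
  · intro b _ hb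
    rw [diagonal_apply_ne' _ hb, zero_mulVec]
  · simp

theorem blockMulVec_single [DecidableEq n] (R : Matrix m n (Matrix (Fin s) (Fin s) k)) (b : n)
    (v : Fin s → k) (a : m) : blockMulVec R (Pi.single b v) a = R a b *ᵥ v := by
  rw [blockMulVec_apply, sum_eq_single b]
  · rw [Pi.single_eq_same]
  · intro c _ hc
    rw [Pi.single_eq_of_ne hc, mulVec_zero]
  · simp

theorem blockMulVec_fromBlocks [Fintype m] {o : Type*} (A : Matrix l m (Matrix (Fin s) (Fin s) k))
    (B : Matrix l n (Matrix (Fin s) (Fin s) k)) (C : Matrix o m (Matrix (Fin s) (Fin s) k))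
    (D : Matrix o n (Matrix (Fin s) (Fin s) k)) (x : m → Fin s → k) (y : n → Fin s → k) :
    blockMulVec (fromBlocks A B C D) (Sum.elim x y) =
      Sum.elim (blockMulVec A x + blockMulVec B y) (blockMulVec C x + blockMulVec D y) := by
  funext a
  rcases a with a | a <;> simp [blockMulVec_apply]

theorem blockMulVec_injective : Function.Injective
    (blockMulVec : Matrix m n (Matrix (Fin s) (Fin s) k) →ₗ[k] _) := by
  classical
  intro R S h
  ext1 a b
  refine ext_of_mulVec_single fun i => ?_
  rw [← blockMulVec_single, h, blockMulVec_single]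

theorem blockMulVec_surjective : Function.Surjective
    (blockMulVec : Matrix m n (Matrix (Fin s) (Fin s) k) →ₗ[k] _) := by
  classical
  intro φ
  refine ⟨of fun a b => LinearMap.toMatrix'
    (LinearMap.proj a ∘ₗ φ ∘ₗ LinearMap.single k (fun _ => Fin s → k) b), ?_⟩
  refine LinearMap.pi_ext fun b v => funext fun a => ?_
  rw [blockMulVec_single, of_apply, LinearMap.toMatrix'_mulVec]
  rfl

theorem blockMulVec_lift [DecidableEq n] (X : BlockTuple k g s n n) (p : FreeAlgebra k (Fin g)) :
    blockMulVec (FreeAlgebra.lift k X p) = FreeAlgebra.lift k (fun j => blockMulVec (X j)) p := by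
  have map_one : (blockMulVec : Matrix n n (Matrix (Fin s) (Fin s) k) →ₗ[k] _) 1 = 1 := by
    refine LinearMap.ext fun x => funext fun a => ?_
    rw [← diagonal_one, blockMulVec_diagonal, one_mulVec]
    rfl
  have h : (AlgHom.ofLinearMap (blockMulVec : _ →ₗ[k] Module.End k (n → Fin s → k)) map_one
      blockMulVec_mul).comp (FreeAlgebra.lift k X) =
      FreeAlgebra.lift k (fun j => blockMulVec (X j)) := by
    ext j
    simp
  exact DFunLike.congr_fun h p

/-- The space of `n`-tuples of vectors of length `s`, a module over the free algebra through
the tuple `X` of block matrices. -/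
abbrev BlockSpace (X : BlockTuple k g s n n) : Type _ := FreeAEval fun j => blockMulVec (X j)

theorem BlockSpace.smul_eq [DecidableEq n] (X : BlockTuple k g s n n) (p : FreeAlgebra k (Fin g))
    (w : BlockSpace X) :
    p • w = (blockMulVec (FreeAlgebra.lift k X p) w : n → Fin s → k) := by
  rw [blockMulVec_lift]
  rfl

theorem BlockSpace.exists_eq_blockMulVec [Fintype m]
    {X : BlockTuple k g s n n} {X' : BlockTuple k g s m m}
    (φ : BlockSpace X →ₗ[FreeAlgebra k (Fin g)] BlockSpace X') :
    ∃ R : Matrix m n (Matrix (Fin s) (Fin s) k),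
      (∀ w, φ w = (blockMulVec R w : m → Fin s → k)) ∧ ∀ j, R * X j = X' j * R := by
  let φ₀ : (n → Fin s → k) →ₗ[k] m → Fin s → k := φ.restrictScalars k
  obtain ⟨R, hR⟩ := blockMulVec_surjective φ₀
  refine ⟨R, fun w => (LinearMap.congr_fun hR w).symm, fun j => blockMulVec_injective ?_⟩
  rw [blockMulVec_mul, blockMulVec_mul, hR]
  refine LinearMap.ext fun (w : BlockSpace X) => ?_
  have h : φ (FreeAlgebra.ι k j • w) = FreeAlgebra.ι k j • φ w := map_smul φ _ w
  exact (congrArg φ (FreeAEval.ι_smul j w).symm).trans (h.trans (FreeAEval.ι_smul j _))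

end

section

variable {k : Type*} [Field k] {g s : ℕ} {Y : Point k g s}
  {m n : Type*} [Fintype m] [DecidableEq m] [Fintype n]

/-- The space of vectors of length `s`, a module over the free algebra through evaluation
at `Y`. -/
abbrev PointModule (Y : Point k g s) : Type _ := FreeAEval fun j => (Y j).mulVecLin

theorem smul_pointModule (Y : Point k g s) (p : FreeAlgebra k (Fin g)) (w : PointModule Y) :
    p • w = (FreeAlgebra.lift k Y p *ᵥ w : Fin s → k) := by
  have h : (toLinAlgEquiv' (R := k) (n := Fin s)).toAlgHom.comp (FreeAlgebra.lift k Y) =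
      FreeAlgebra.lift k fun j => (Y j).mulVecLin := by
    ext j
    simp
  rw [FreeAEval.smul_eq_lift, ← h]
  rfl

theorem IsSemisimplePoint.isSemisimpleModule (hY : IsSemisimplePoint Y) :
    IsSemisimpleModule (FreeAlgebra k (Fin g)) (PointModule Y) := by
  refine { exists_isCompl W := ?_ }
  obtain ⟨W', hW', hc⟩ := hY (W.restrictScalars k) fun j w hw =>
    (FreeAEval.ι_smul (a := fun j => (Y j).mulVecLin) j w).subst (W.smul_mem (FreeAlgebra.ι k j) hw)
  have smul_mem (p : FreeAlgebra k (Fin g)) (w : PointModule Y) (hw : w ∈ W') : p • w ∈ W' := by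
    induction p using FreeAlgebra.induction generalizing w with
    | grade0 c => exact algebraMap_smul (FreeAlgebra k (Fin g)) c w ▸ W'.smul_mem c hw
    | grade1 j => exact FreeAEval.ι_smul (a := fun j => (Y j).mulVecLin) j w ▸ hW' j w hw
    | mul p q hp hq => exact mul_smul p q w ▸ hp _ (hq w hw)
    | add p q hp hq => exact add_smul p q w ▸ W'.add_mem (hp w hw) (hq w hw)
  exact ⟨{ W' with smul_mem' := fun p w hw => smul_mem p w hw },
    (Submodule.isCompl_restrictScalars_iff k).1 hc⟩

theorem IsSemisimplePoint.exists_injective_pi {N : Type*} [AddCommGroup N]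
    [Module (FreeAlgebra k (Fin g)) N] [Module.Finite (FreeAlgebra k (Fin g)) N]
    (hY : IsSemisimplePoint Y) (hN : ∀ p ∈ vanishingIdeal Y, ∀ x : N, p • x = 0) :
    ∃ (ι : Type) (_ : Fintype ι) (π : N →ₗ[FreeAlgebra k (Fin g)] ι → PointModule Y),
      Function.Injective π := by
  have := hY.isSemisimpleModule
  obtain ⟨t, κ, hκ⟩ := Module.Finite.exists_fin' (FreeAlgebra k (Fin g)) N
  let e (i : Fin s) : PointModule Y := (Pi.single i 1 : Fin s → k)
  let η : (Fin t → FreeAlgebra k (Fin g)) →ₗ[FreeAlgebra k (Fin g)]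
      Fin t × Fin s → PointModule Y := LinearMap.pi fun i =>
    LinearMap.toSpanSingleton _ (PointModule Y) (e i.2) ∘ₗ LinearMap.proj i.1
  have hη : LinearMap.ker η ≤ LinearMap.ker κ := by
    intro c hc
    have coeff_mem (i : Fin t) : c i ∈ vanishingIdeal Y := by
      refine RingHom.mem_ker.2 (ext_of_mulVec_single fun r => ?_)
      rw [zero_mulVec]
      have h : c i • e r = 0 := congrFun hc (i, r)
      rwa [smul_pointModule] at h
    have hc : c = ∑ i, c i • Pi.single i 1 := pi_eq_sum_univ' c
    rw [LinearMap.mem_ker, hc, map_sum]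
    exact sum_eq_zero fun i _ => by rw [map_smul, hN _ (coeff_mem i)]
  have injective_liftQ : Function.Injective ((LinearMap.ker η).liftQ η le_rfl) :=
    LinearMap.ker_eq_bot.1 (Submodule.ker_liftQ_eq_bot _ _ _ le_rfl)
  have := IsSemisimpleModule.of_injective _ injective_liftQ
  obtain ⟨σ, hσ⟩ := IsSemisimpleModule.lifting_property ((LinearMap.ker η).liftQ κ hη)
    (fun x => (hκ x).imp' Submodule.Quotient.mk fun _ h => h) LinearMap.id
  exact ⟨Fin t × Fin s, inferInstance, (LinearMap.ker η).liftQ η le_rfl ∘ₗ σ,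
    injective_liftQ.comp (Function.LeftInverse.injective (LinearMap.congr_fun hσ))⟩

variable {N : Type*} [AddCommGroup N] [Module k N]
  [Module (FreeAlgebra k (Fin g)) N] [IsScalarTower k (FreeAlgebra k (Fin g)) N]

theorem exists_blockTuple_smul_eq {N' : Submodule (FreeAlgebra k (Fin g)) N}
    {T : BlockTuple k g s m m} {θ' : N' →ₗ[FreeAlgebra k (Fin g)] BlockSpace (blockPoint Y T)}
    {θ₁ : N →ₗ[k] m → Fin s → k} (hθ₁ : ∀ x : N', θ₁ x = θ' x) {ρ : N →ₗ[k] n → Fin s → k}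
    (hρ : LinearMap.ker ρ ≤ N'.restrictScalars k) :
    ∃ B : BlockTuple k g s m n, ∀ (j : Fin g) (x : N),
      θ₁ (FreeAlgebra.ι k j • x) =
        blockMulVec (blockPoint Y T j) (θ₁ x) + blockMulVec (B j) (ρ x) := by
  let δ (j : Fin g) : N →ₗ[k] m → Fin s → k :=
    θ₁ ∘ₗ Algebra.lsmul k k N (FreeAlgebra.ι k j) - blockMulVec (blockPoint Y T j) ∘ₗ θ₁
  have ker_le (j : Fin g) : LinearMap.ker ρ ≤ LinearMap.ker (δ j) := by
    intro x hx
    lift x to N' using hρ hx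
    have h : θ' (FreeAlgebra.ι k j • x) = (blockMulVec (blockPoint Y T j) (θ' x) : m → Fin s → k) :=
      (map_smul θ' _ x).trans (FreeAEval.ι_smul j _)
    rw [← hθ₁, ← hθ₁] at h
    exact sub_eq_zero.2 h
  choose β hβ using fun j => exists_comp_eq_of_ker_le_ker (ker_le j)
  choose B hB using fun j => blockMulVec_surjective (β j)
  refine ⟨B, fun j x => ?_⟩
  have h : blockMulVec (B j) (ρ x) = δ j x := hB j ▸ LinearMap.congr_fun (hβ j) x
  rw [h]
  exact (add_sub_cancel _ _).symm

theorem exists_injective_blockSpace_fromBlocks [DecidableEq n]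
    {N' : Submodule (FreeAlgebra k (Fin g)) N}
    {T : BlockTuple k g s m m} {θ' : N' →ₗ[FreeAlgebra k (Fin g)] BlockSpace (blockPoint Y T)}
    (hθ' : Function.Injective θ') {π : N ⧸ N' →ₗ[FreeAlgebra k (Fin g)] n → PointModule Y}
    (hπ : Function.Injective π) :
    ∃ (B : BlockTuple k g s m n) (θ : N →ₗ[FreeAlgebra k (Fin g)]
      BlockSpace (blockPoint Y fun j => fromBlocks (T j) (B j) 0 0)), Function.Injective θ := by
  let ρ : N →ₗ[k] n → Fin s → k := (π ∘ₗ N'.mkQ).restrictScalars k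
  obtain ⟨(θ₁ : N →ₗ[k] m → Fin s → k), hθ₁⟩ :=
    LinearMap.exists_extend (p := N'.restrictScalars k) (θ'.restrictScalars k)
  have θ₁_eq (x : N') : θ₁ x = θ' x := LinearMap.congr_fun hθ₁ x
  have mem_of_ρ_eq_zero (x : N) (hx : ρ x = 0) : x ∈ N' :=
    (Submodule.Quotient.mk_eq_zero N').1 (hπ (hx.trans (map_zero π).symm))
  obtain ⟨B, hB⟩ := exists_blockTuple_smul_eq θ₁_eq mem_of_ρ_eq_zero
  let φ : N →ₗ[k] m ⊕ n → Fin s → k :=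
    (LinearEquiv.sumArrowLequivProdArrow m n k (Fin s → k)).symm.toLinearMap ∘ₗ θ₁.prod ρ
  have φ_apply (x : N) : φ x = Sum.elim (θ₁ x) (ρ x) := rfl
  have ρ_smul (j : Fin g) (x : N) :
      ρ (FreeAlgebra.ι k j • x) = blockMulVec (diagonalTuple n Y j) (ρ x) := by
    funext a
    rw [diagonalTuple, blockMulVec_diagonal]
    have h : π (N'.mkQ (FreeAlgebra.ι k j • x)) = FreeAlgebra.ι k j • π (N'.mkQ x) := by
      rw [map_smul, map_smul]
    exact (congrFun h a).trans (FreeAEval.ι_smul j _)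
  have φ_smul (j : Fin g) (x : N) : φ (FreeAlgebra.ι k j • x) =
      blockMulVec (blockPoint Y (fun j => fromBlocks (T j) (B j) 0 0) j) (φ x) := by
    have h : blockPoint Y (fun j => fromBlocks (T j) (B j) 0 0) j =
        fromBlocks (blockPoint Y T j) (B j) 0 (diagonalTuple n Y j) :=
      (blockPoint_fromBlocks T B 0 j).trans (by rw [blockPoint_zero])
    rw [h, φ_apply, φ_apply, blockMulVec_fromBlocks, hB, ρ_smul, map_zero, LinearMap.zero_apply,
      zero_add]
  refine ⟨B, FreeAEval.homOfGenerators φ φ_smul, ?_⟩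
  refine (injective_iff_map_eq_zero _).2 fun x (hx : φ x = 0) => ?_
  lift x to N' using mem_of_ρ_eq_zero x (funext fun a => congrFun hx (Sum.inr a))
  have h : θ' x = 0 := (θ₁_eq x).symm.trans (funext fun a => congrFun hx (Sum.inl a))
  rw [(injective_iff_map_eq_zero θ').1 hθ' x h, Submodule.coe_zero]

theorem IsSemisimplePoint.exists_injective_blockSpace [Module.Finite k N]
    (hY : IsSemisimplePoint Y) (ℓ : ℕ) (hN : ∀ p ∈ vanishingIdeal Y ^ ℓ, ∀ x : N, p • x = 0) :
    ∃ (m : Type) (_ : Fintype m) (_ : DecidableEq m) (T : BlockTuple k g s m m)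
      (θ : N →ₗ[FreeAlgebra k (Fin g)] BlockSpace (blockPoint Y T)),
      tensorMatrix T ^ ℓ = 0 ∧ Function.Injective θ := by
  induction ℓ generalizing N with
  | zero =>
    have : Subsingleton N := ⟨fun x y => by
      have h (x : N) : x = 0 := by simpa using hN 1 (by simp [Submodule.pow_zero]) x
      rw [h x, h y]⟩
    exact ⟨Fin 0, inferInstance, inferInstance, 0, 0, Subsingleton.elim _ _,
      Function.injective_of_subsingleton _⟩
  | succ ℓ ih =>
    let N' : Submodule (FreeAlgebra k (Fin g)) N := vanishingIdeal Y • ⊤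
    rw [Submodule.pow_succ] at hN
    have smul_eq_zero (p : FreeAlgebra k (Fin g)) (hp : p ∈ vanishingIdeal Y ^ ℓ) (x : N') :
        p • x = 0 := Subtype.ext (smul_eq_zero_of_mem_smul_top hN hp x.2)
    have smul_quotient_eq_zero (p : FreeAlgebra k (Fin g)) (hp : p ∈ vanishingIdeal Y)
        (x : N ⧸ N') : p • x = 0 := by
      obtain ⟨x, rfl⟩ := Submodule.Quotient.mk_surjective N' x
      exact (Submodule.Quotient.mk_eq_zero N').2 (Submodule.smul_mem_smul hp trivial)
    have : Module.Finite (FreeAlgebra k (Fin g)) N := Module.Finite.of_restrictScalars_finite k _ _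
    have : Module.Finite k N' := inferInstanceAs (Module.Finite k (N'.restrictScalars k))
    obtain ⟨m, _, _, T, θ', hT, hθ'⟩ := ih (N := N') smul_eq_zero
    obtain ⟨n, _, π, hπ⟩ := hY.exists_injective_pi smul_quotient_eq_zero
    classical
    obtain ⟨B, θ, hθ⟩ := exists_injective_blockSpace_fromBlocks hθ' hπ
    exact ⟨m ⊕ n, inferInstance, inferInstance, _, θ,
      tensorMatrix_fromBlocks_pow_succ_eq_zero hT B, hθ⟩

end

/-! ### Approximation of germs by polynomials -/

section

variable {k : Type*} [Field k] {g s : ℕ} {Y : Point k g s}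
  {f : MultiSeq k (Point k g s) (Matrix (Fin s) (Fin s) k)}
  {m n : Type*} [Fintype m] [DecidableEq m] [Fintype n] [DecidableEq n]

theorem finite_quotient_vanishingIdeal_pow (Y : Point k g s) (n : ℕ) :
    Module.Finite k (FreeAlgebra k (Fin g) ⧸ vanishingIdeal Y ^ n) := by
  have h : ((vanishingIdeal Y).restrictScalars k).CoFG :=
    Submodule.CoFG.ker (FreeAlgebra.lift k Y).toLinearMap
  have := cofg_restrictScalars_pow h n
  exact Module.Finite.equiv (Submodule.Quotient.restrictScalarsEquiv k (vanishingIdeal Y ^ n))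

theorem IsSemisimplePoint.exists_annihilator_le (hY : IsSemisimplePoint Y) (ℓ : ℕ) :
    ∃ (m : Type) (_ : Fintype m) (_ : DecidableEq m) (T : BlockTuple k g s m m)
      (w : m → Fin s → k), tensorMatrix T ^ ℓ = 0 ∧ ∀ p : FreeAlgebra k (Fin g),
        blockMulVec (FreeAlgebra.lift k (blockPoint Y T) p) w = 0 → p ∈ vanishingIdeal Y ^ ℓ := by
  have := finite_quotient_vanishingIdeal_pow Y ℓ
  obtain ⟨m, _, _, T, θ, hT, hθ⟩ := hY.exists_injective_blockSpace
    (N := FreeAlgebra k (Fin g) ⧸ vanishingIdeal Y ^ ℓ) ℓ fun p hp x => by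
      obtain ⟨q, rfl⟩ := Submodule.Quotient.mk_surjective _ x
      exact (Submodule.Quotient.mk_eq_zero _).2 (Ideal.mul_mem_right _ _ hp)
  refine ⟨m, _, _, T, θ (Submodule.Quotient.mk 1), hT, fun p hp => ?_⟩
  have smul_eq_zero : p • θ (Submodule.Quotient.mk 1) = 0 := (BlockSpace.smul_eq _ _ _).trans hp
  rw [← map_smul, ← Submodule.Quotient.mk_smul, smul_eq_mul, mul_one,
    map_eq_zero_iff θ hθ] at smul_eq_zero
  exact (Submodule.Quotient.mk_eq_zero _).1 smul_eq_zero

theorem IsSemisimplePoint.mem_vanishingIdeal_pow_iff (hY : IsSemisimplePoint Y) {ℓ : ℕ}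
    {p : FreeAlgebra k (Fin g)} :
    p ∈ vanishingIdeal Y ^ ℓ ↔ taylor Y p ∈ MultiSeq.orderIdeal k _ _ ℓ := by
  refine ⟨taylor_mem_orderIdeal, fun hp => ?_⟩
  obtain ⟨m, _, _, T, w, hT, hw⟩ := hY.exists_annihilator_le ℓ
  refine hw p ?_
  rw [← nilEval_taylor Y p hT, MultiSeq.nilEval_eq_zero hp, map_zero, LinearMap.zero_apply]

theorem higherVanishingIdeal_eq_pow (hY : IsSemisimplePoint Y) (ℓ : ℕ) :
    higherVanishingIdeal Y ℓ = vanishingIdeal Y ^ (ℓ + 1) :=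
  Ideal.ext fun _ => mem_higherVanishingIdeal_iff.trans hY.mem_vanishingIdeal_pow_iff.symm

theorem LAC.blockMulVec_nilEval_mem (hY : IsSemisimplePoint Y) (hf : LAC Y f) {ℓ : ℕ}
    {T : BlockTuple k g s n n} (hT : tensorMatrix T ^ ℓ = 0)
    (U : Submodule (FreeAlgebra k (Fin g)) (BlockSpace (blockPoint Y T)))
    {u : BlockSpace (blockPoint Y T)} (hu : u ∈ U) :
    (blockMulVec (f.nilEval ℓ T) u : n → Fin s → k) ∈ U := by
  have smul_eq_zero (p : FreeAlgebra k (Fin g)) (hp : p ∈ vanishingIdeal Y ^ ℓ)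
      (x : BlockSpace (blockPoint Y T) ⧸ U) : p • x = 0 := by
    obtain ⟨w, rfl⟩ := Submodule.Quotient.mk_surjective U x
    rw [← Submodule.Quotient.mk_smul, BlockSpace.smul_eq, lift_blockPoint_eq_zero hT hp, map_zero]
    rfl
  have : Module.Finite k (BlockSpace (blockPoint Y T) ⧸ U) :=
    Module.Finite.equiv (Submodule.Quotient.restrictScalarsEquiv k U)
  obtain ⟨m, _, _, T', θ, hT', hθ⟩ := hY.exists_injective_blockSpace ℓ smul_eq_zero
  obtain ⟨R, hR, hR_comm⟩ := BlockSpace.exists_eq_blockMulVec (θ ∘ₗ U.mkQ)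
  have mem_iff (w : BlockSpace (blockPoint Y T)) : w ∈ U ↔ blockMulVec R w = 0 := by
    rw [← Submodule.Quotient.mk_eq_zero, ← hθ.eq_iff, map_zero]
    exact Eq.congr_left (hR w)
  rw [mem_iff] at hu
  refine (mem_iff _).2 ?_
  calc blockMulVec R (blockMulVec (f.nilEval ℓ T) u)
      = blockMulVec (R * f.nilEval ℓ T) u := by rw [blockMulVec_mul]; rfl
    _ = blockMulVec (f.nilEval ℓ T') (blockMulVec R u) := by
      rw [hf.mul_nilEval hT hT' hR_comm, blockMulVec_mul]; rfl
    _ = 0 := by rw [hu, map_zero]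

theorem LAC.exists_blockMulVec_lift_eq (hY : IsSemisimplePoint Y) (hf : LAC Y f) {ℓ : ℕ}
    {T : BlockTuple k g s n n} (hT : tensorMatrix T ^ ℓ = 0) (w : n → Fin s → k) :
    ∃ p : FreeAlgebra k (Fin g),
      blockMulVec (FreeAlgebra.lift k (blockPoint Y T) p) w = blockMulVec (f.nilEval ℓ T) w := by
  let U : Submodule (FreeAlgebra k (Fin g)) (BlockSpace (blockPoint Y T)) :=
    Submodule.span _ {(w : BlockSpace (blockPoint Y T))}
  obtain ⟨p, hp⟩ := (Submodule.mem_span_singleton (M := BlockSpace (blockPoint Y T))).1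
    (hf.blockMulVec_nilEval_mem hY hT U (Submodule.mem_span_singleton_self _))
  exact ⟨p, (BlockSpace.smul_eq (blockPoint Y T) p w).symm.trans hp⟩

theorem LAC.exists_blockMulVec_lift_eq₂ (hY : IsSemisimplePoint Y) (hf : LAC Y f) {ℓ : ℕ}
    {T : BlockTuple k g s m m} {T' : BlockTuple k g s n n} (hT : tensorMatrix T ^ ℓ = 0)
    (hT' : tensorMatrix T' ^ ℓ = 0) (w : m → Fin s → k) (w' : n → Fin s → k) :
    ∃ p : FreeAlgebra k (Fin g),
      blockMulVec (FreeAlgebra.lift k (blockPoint Y T) p) w = blockMulVec (f.nilEval ℓ T) w ∧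
      blockMulVec (FreeAlgebra.lift k (blockPoint Y T') p) w' =
        blockMulVec (f.nilEval ℓ T') w' := by
  let T₂ : BlockTuple k g s (m ⊕ n) (m ⊕ n) := fun j => fromBlocks (T j) 0 0 (T' j)
  have hT₂ : tensorMatrix T₂ ^ ℓ = 0 := by
    rw [tensorMatrix_fromBlocks_diagonal_pow, hT, hT', fromBlocks_zero]
  have blockMulVec_nilEval (h : MultiSeq k (Point k g s) (Matrix (Fin s) (Fin s) k)) :
      blockMulVec (h.nilEval ℓ T₂) (Sum.elim w w') =
        Sum.elim (blockMulVec (h.nilEval ℓ T) w) (blockMulVec (h.nilEval ℓ T') w') := by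
    rw [MultiSeq.nilEval_fromBlocks_diagonal]
    refine (blockMulVec_fromBlocks _ _ _ _ _ _).trans ?_
    simp only [map_zero, LinearMap.zero_apply, add_zero, zero_add]
  obtain ⟨p, hp⟩ := hf.exists_blockMulVec_lift_eq hY hT₂ (Sum.elim w w')
  rw [← nilEval_taylor Y p hT₂, blockMulVec_nilEval, blockMulVec_nilEval, Sum.elim_eq_iff,
    nilEval_taylor Y p hT, nilEval_taylor Y p hT'] at hp
  exact ⟨p, hp⟩

theorem LAC.exists_nilEval_eq_taylor (hY : IsSemisimplePoint Y) (hf : LAC Y f) (ℓ : ℕ) :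
    ∃ p : FreeAlgebra k (Fin g), ∀ (n : Type) [Fintype n] [DecidableEq n]
      (T : BlockTuple k g s n n), tensorMatrix T ^ ℓ = 0 →
        f.nilEval ℓ T = (taylor Y p).nilEval ℓ T := by
  obtain ⟨m, _, _, T₀, w₀, hT₀, hw₀⟩ := hY.exists_annihilator_le ℓ
  obtain ⟨p, hp⟩ := hf.exists_blockMulVec_lift_eq hY hT₀ w₀
  refine ⟨p, fun n _ _ T hT => blockMulVec_injective (LinearMap.ext fun w => ?_)⟩
  obtain ⟨q, hq₀, hq⟩ := hf.exists_blockMulVec_lift_eq₂ hY hT₀ hT w₀ w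
  have sub_mem : q - p ∈ vanishingIdeal Y ^ ℓ := hw₀ _ (by
    rw [map_sub, map_sub, LinearMap.sub_apply, hq₀, hp, sub_self])
  have lift_eq : FreeAlgebra.lift k (blockPoint Y T) q = FreeAlgebra.lift k (blockPoint Y T) p :=
    sub_eq_zero.1 ((map_sub _ _ _).symm.trans (lift_blockPoint_eq_zero hT sub_mem))
  rw [nilEval_taylor Y p hT, ← lift_eq, hq]

theorem LAC.exists_sub_taylor_mem_orderIdeal (hY : IsSemisimplePoint Y) (hf : LAC Y f) (ℓ : ℕ) :
    ∃ p : FreeAlgebra k (Fin g), f - taylor Y p ∈ MultiSeq.orderIdeal k _ _ ℓ := by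
  cases ℓ with
  | zero => exact ⟨0, fun i hi => absurd hi i.not_lt_zero⟩
  | succ ℓ =>
    obtain ⟨p, hp⟩ := hf.exists_nilEval_eq_taylor hY (ℓ + 1)
    refine ⟨p, MultiSeq.mem_orderIdeal_of_nilEval_superdiagonal_eq_zero fun z => ?_⟩
    rw [MultiSeq.nilEval_sub, hp _ _ (tensorMatrix_superdiagonal_pow_eq_zero ℓ z), sub_self]

theorem LAC.of_forall_exists_sub_mem_orderIdeal
    (hf : ∀ ℓ, ∃ h, LAC Y h ∧ f - h ∈ MultiSeq.orderIdeal k _ _ ℓ) : LAC Y f := by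
  rw [lac_iff_app]
  intro n i hi S z
  obtain ⟨h, hh, hfh⟩ := hf (n + 2)
  have app_eq (m : ℕ) (hm : m < n + 2) (z) : f.app m z = h.app m z :=
    DFunLike.congr_fun (sub_eq_zero.1 (hfh m hm)) _
  simpa only [app_eq (n + 1) (by omega), app_eq n (by omega)] using
    (lac_iff_app Y h).1 hh n i hi S z

/-- The formal germ of a noncommutative polynomial. -/
noncomputable def taylorGerm (Y : Point k g s) : FreeAlgebra k (Fin g) →ₐ[k] formalGerms Y :=
  (taylor Y).codRestrict (formalGerms Y) (lac_taylor Y)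

/-- The germs about `Y` whose terms of degree less than `ℓ` vanish. -/
def germOrderIdeal (Y : Point k g s) (ℓ : ℕ) : Ideal (formalGerms Y) :=
  (MultiSeq.orderIdeal k _ _ ℓ).comap (formalGerms Y).val

instance (ℓ : ℕ) : (germOrderIdeal Y ℓ).IsTwoSided :=
  inferInstanceAs (Ideal.comap _ _).IsTwoSided

theorem germOrderIdeal_antitone : Antitone (germOrderIdeal Y) :=
  fun _ _ h _ hf i hi => hf i (hi.trans_le h)

theorem iInf_germOrderIdeal : ⨅ ℓ, germOrderIdeal Y ℓ = ⊥ := by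
  refine eq_bot_iff.2 fun f hf => Subtype.ext (funext fun m => ?_)
  rw [Submodule.mem_iInf] at hf
  exact hf (m + 1) m m.lt_succ_self

theorem exists_germ_of_cauchy (p : ℕ → FreeAlgebra k (Fin g))
    (hp : ∀ m n, m ≤ n → p n - p m ∈ vanishingIdeal Y ^ m) :
    ∃ f : formalGerms Y, ∀ ℓ, f - taylorGerm Y (p ℓ) ∈ germOrderIdeal Y ℓ := by
  let F : MultiSeq k (Point k g s) (Matrix (Fin s) (Fin s) k) := fun m => taylor Y (p (m + 1)) m
  have sub_mem (ℓ : ℕ) : F - taylor Y (p ℓ) ∈ MultiSeq.orderIdeal k _ _ ℓ := fun m hm => by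
    have h := taylor_mem_orderIdeal (hp (m + 1) ℓ hm) m m.lt_succ_self
    rw [map_sub] at h
    exact sub_eq_zero.2 (sub_eq_zero.1 h).symm
  exact ⟨⟨F, LAC.of_forall_exists_sub_mem_orderIdeal
    fun ℓ => ⟨_, lac_taylor Y (p ℓ), sub_mem ℓ⟩⟩, sub_mem⟩

end

end FreeAnalysis

open FreeAnalysis in
theorem theoremE_general {k : Type*} [Field k] {g s : ℕ} (Y : Point k g s)
    (hY : IsSemisimplePoint Y) :
    (∀ ℓ : ℕ, higherVanishingIdeal Y ℓ = vanishingIdeal Y ^ (ℓ + 1)) ∧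
    ∃ Φ : formalGerms Y ≃ₐ[k] powerCompletion (k := k) (vanishingIdeal Y),
      ∀ (f : formalGerms Y) (ℓ : ℕ) (p : FreeAlgebra k (Fin g)),
        (Φ f).1 ℓ = Ideal.Quotient.mk (vanishingIdeal Y ^ ℓ) p ↔
          ∀ m < ℓ, ∀ Z : Fin m → Point k g s, f.1 m Z = ncDiff Y p m Z := by
  obtain ⟨Φ, hΦ⟩ := exists_algEquiv_powerCompletion (vanishingIdeal Y) (taylorGerm Y)
    (germOrderIdeal Y) germOrderIdeal_antitone
    (fun ℓ => Ideal.ext fun p => hY.mem_vanishingIdeal_pow_iff.symm)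
    (fun ℓ f => f.2.exists_sub_taylor_mem_orderIdeal hY ℓ) iInf_germOrderIdeal
    exists_germ_of_cauchy
  exact ⟨higherVanishingIdeal_eq_pow hY, Φ, fun f ℓ p =>
    (hΦ f ℓ p).trans sub_taylor_mem_orderIdeal_iff⟩

theorem theoremE {k : Type*} [Field k] [CharZero k] {g s : ℕ} (Y : FreeAnalysis.Point k g s)
    (hY : FreeAnalysis.IsSemisimplePoint Y) :
    (∀ ℓ : ℕ, FreeAnalysis.higherVanishingIdeal Y ℓ =
      FreeAnalysis.vanishingIdeal Y ^ (ℓ + 1)) ∧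
    ∃ Φ : FreeAnalysis.formalGerms Y ≃ₐ[k]
        FreeAnalysis.powerCompletion (k := k) (FreeAnalysis.vanishingIdeal Y),
      ∀ (f : FreeAnalysis.formalGerms Y) (ℓ : ℕ) (p : FreeAlgebra k (Fin g)),
        (Φ f).1 ℓ = Ideal.Quotient.mk (FreeAnalysis.vanishingIdeal Y ^ ℓ) p ↔
          ∀ m < ℓ, ∀ Z : Fin m → FreeAnalysis.Point k g s,
            f.1 m Z = FreeAnalysis.ncDiff Y p m Z :=
  theoremE_general Y hY
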